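/- Let $q\in\mathbb C$ with $|q|=1$, $q$ not a root of unity, fix a square root $q^{1/2}$ of $q$, and write $[n]_q=\frac{q^n-q^{-n}}{q-q^{-1}}$, $[n]_q!=[1]_q\cdots[n]_q$. Let $\mathcal A=SL_q(2,\mathbb R)$ be the unital complex $*$-algebra generated by self-adjoint elements $a,b,c,d$ with relations $$ab=q\,ba,\quad ac=q\,ca,\quad bc=cb,\quad bd=q\,db,\quad cd=q\,dc,\quad da-q^{-1}bc=1=ad-q\,bc,$$ with the Hopf algebra structure $\Delta\begin{pmatrix}a&b\\c&d\end{pmatrix}=\begin{pmatrix}a&b\\c&d\end{pmatrix}\otimes\begin{pmatrix}a&b\\c&d\end{pmatrix}$, $\varepsilon\begin{pmatrix}a&b\\c&d\end{pmatrix}=\begin{pmatrix}1&0\\0&1\end{pmatrix}$, $S\begin{pmatrix}a&b\\c&d\end{pmatrix}=\begin{pmatrix}d&-q^{-1}b\\-q\,c&a\end{pmatrix}$, and let $\tau=*\circ S$. Let $\mu\in\mathbb R\setminus\{0\}$ and $\nu=\mu^2$. The space $\mathcal C=\mathrm{Span}\{a-d+2q^{1/2}\mu\,b,\ q\nu\,b+c\}$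 is a $\tau$-invariant two-sided coideal; let $\mathbf R_q=\mathcal A/\mathcal C\mathcal A$ be the quotient of $\mathcal A$ by the right ideal generated by $\mathcal C$, with its quotient structures of coalgebra and right $\mathcal A$-module (denoted $\cdot$), with the conjugate-linear map $\tau$ induced on it, and with quotient map $r$. Put $$v_n=r\big[(a+q^{1/2}\mu b)(a+q^{3/2}\mu b)\cdots(a+q^{n-1/2}\mu b)\big]\quad(n\ge 0,\ v_0=r[1]),$$ $$X_n=\sum_{i=1}^n\frac{(q-q^{-1})^{i-1}q^{i/2}\mu^i\,[n-1]_q!}{[i]_q\,[n-i]_q!}\;v_{n-i}\cdot b^i\quad(n\ge1).$$ (i) Let $\mathbf R_q^{(0)}=\mathrm{Span}\{v_0\}$ and $\mathbf R_q^{(n)}=\mathrm{Span}\{v_n,X_n\}$ for $n>0$. Each $\mathbf R_q^{(n)}$ is a cocommutative subcoalgebra of $\mathbf R_q$, and $\mathbf R_q=\bigoplus_{n\in\mathbb N}\mathbf R_q^{(n)}$. (ii) Every $v_n$ is group-like, and the simple subcoalgebras of $\mathbf R_q$ are exactly the lines $\mathrm{Span}\{v_n\}$, $n\in\mathbb N$;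 in particular $\mathbf R_q$ is pointed (all its simple subcoalgebras are one-dimensional). The corresponding one-dimensional corepresentations $\rho_n:\mathbb C\to\mathbb C\otimes\mathbf R_q$, $\rho_n(1)=1\otimes v_n$, are unitary. Here a corepresentation on an inner product space with matrix coefficients $\rho_{ij}$ in an orthonormal basis is called unitary if $\tau(\rho_{ij})=\rho_{ji}$ for all $i,j$. (iii) No complex Hopf algebra is isomorphic to $\mathbf R_q$ as a coalgebra. -/

import Mathlib

open scoped TensorProduct ComplexConjugate


noncomputable section

/-! ### The quantum group `SL_q(2, ℝ)` as a Hopf algebra with involution, for `|q| = 1` -/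

namespace QuantumSL2

/-- The four generators. -/
inductive Gen : Type
  | a | b | c | d

open Gen

/-- The generators in the free algebra. -/
abbrev fr (g : Gen) : FreeAlgebra ℂ Gen := FreeAlgebra.ι ℂ g

/-- The defining relations of `SL_q(2)`. -/
inductive Rel (q : Circle) : FreeAlgebra ℂ Gen → FreeAlgebra ℂ Gen → Prop
  | ab : Rel q (fr a * fr b) ((q : ℂ) • (fr b * fr a))
  | ac : Rel q (fr a * fr c) ((q : ℂ) • (fr c * fr a))
  | bc : Rel q (fr b * fr c) (fr c * fr b)
  | bd : Rel q (fr b * fr d) ((q : ℂ) • (fr d * fr b))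
  | cd : Rel q (fr c * fr d) ((q : ℂ) • (fr d * fr c))
  | da : Rel q (fr d * fr a - (q : ℂ)⁻¹ • (fr b * fr c)) 1
  | ad : Rel q (fr a * fr d - (q : ℂ) • (fr b * fr c)) 1

/-- The function algebra on `SL_q(2, ℝ)`: the unital complex algebra generated by `a, b, c, d`
subject to the relations `Rel`. -/
def SLq (q : Circle) : Type := RingQuot (Rel q)

namespace SLq

variable {q : Circle}

instance : Ring (SLq q) := inferInstanceAs (Ring (RingQuot (Rel q)))
instance : Algebra ℂ (SLq q) := inferInstanceAs (Algebra ℂ (RingQuot (Rel q)))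

variable (q) in
/-- The quotient map from the free algebra. -/
def mk : FreeAlgebra ℂ Gen →ₐ[ℂ] SLq q := RingQuot.mkAlgHom ℂ (Rel q)

variable (q) in
/-- The image of a generator. -/
def gen (g : Gen) : SLq q := mk q (fr g)

theorem mk_rel {x y : FreeAlgebra ℂ Gen} (h : Rel q x y) : mk q x = mk q y :=
  RingQuot.mkAlgHom_rel ℂ h

theorem rel_ab : gen q a * gen q b = (q : ℂ) • (gen q b * gen q a) := by
  simpa [gen] using mk_rel (Rel.ab (q := q))
theorem rel_ac : gen q a * gen q c = (q : ℂ) • (gen q c * gen q a) := by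
  simpa [gen] using mk_rel (Rel.ac (q := q))
theorem rel_bc : gen q b * gen q c = gen q c * gen q b := by
  simpa [gen] using mk_rel (Rel.bc (q := q))
theorem rel_bd : gen q b * gen q d = (q : ℂ) • (gen q d * gen q b) := by
  simpa [gen] using mk_rel (Rel.bd (q := q))
theorem rel_cd : gen q c * gen q d = (q : ℂ) • (gen q d * gen q c) := by
  simpa [gen] using mk_rel (Rel.cd (q := q))
theorem rel_da : gen q d * gen q a - (q : ℂ)⁻¹ • (gen q b * gen q c) = 1 := by
  simpa [gen] using mk_rel (Rel.da (q := q))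
theorem rel_ad : gen q a * gen q d - (q : ℂ) • (gen q b * gen q c) = 1 := by
  simpa [gen] using mk_rel (Rel.ad (q := q))

/-- Induction on elements of `SL_q(2)`. -/
theorem induction {P : SLq q → Prop} (hs : ∀ z : ℂ, P (algebraMap ℂ _ z))
    (hg : ∀ g, P (gen q g)) (hm : ∀ x y, P x → P y → P (x * y))
    (ha : ∀ x y, P x → P y → P (x + y)) (x : SLq q) : P x := by
  obtain ⟨y, rfl⟩ : ∃ y, mk q y = x := RingQuot.mkAlgHom_surjective ℂ (Rel q) x
  induction y using FreeAlgebra.induction with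
  | grade0 z => simpa using hs z
  | grade1 g => exact hg g
  | mul x y hx hy => simpa using hm _ _ hx hy
  | add x y hx hy => simpa using ha _ _ hx hy

/-- The universal property of `SL_q(2)`. -/
def lift {B : Type*} [Ring B] [Algebra ℂ B] (f : Gen → B)
    (hab : f a * f b = (q : ℂ) • (f b * f a)) (hac : f a * f c = (q : ℂ) • (f c * f a))
    (hbc : f b * f c = f c * f b) (hbd : f b * f d = (q : ℂ) • (f d * f b))
    (hcd : f c * f d = (q : ℂ) • (f d * f c))
    (hda : f d * f a - (q : ℂ)⁻¹ • (f b * f c) = 1)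
    (had : f a * f d - (q : ℂ) • (f b * f c) = 1) : SLq q →ₐ[ℂ] B :=
  RingQuot.liftAlgHom ℂ ⟨FreeAlgebra.lift ℂ f, by
    intro x y h
    cases h <;> simp <;> assumption⟩

@[simp] theorem lift_gen {B : Type*} [Ring B] [Algebra ℂ B] (f : Gen → B)
    (hab hac hbc hbd hcd hda had) (g : Gen) :
    lift (q := q) f hab hac hbc hbd hcd hda had (gen q g) = f g := by
  simp only [lift, gen, mk, fr]
  erw [RingQuot.liftAlgHom_mkAlgHom_apply]
  simp

theorem algHom_ext {B : Type*} [Ring B] [Algebra ℂ B] {f g : SLq q →ₐ[ℂ] B}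
    (h : ∀ x, f (gen q x) = g (gen q x)) : f = g := by
  ext x
  induction x using induction with
  | hs z => simp
  | hg x => exact h x
  | hm x y hx hy => simp [hx, hy]
  | ha x y hx hy => simp [hx, hy]

/-- The coproduct on generators: the matrix `(a b; c d)` is multiplicative. -/
def comulGen (q : Circle) : Gen → SLq q ⊗[ℂ] SLq q
  | a => gen q a ⊗ₜ gen q a + gen q b ⊗ₜ gen q c
  | b => gen q a ⊗ₜ gen q b + gen q b ⊗ₜ gen q d
  | c => gen q c ⊗ₜ gen q a + gen q d ⊗ₜ gen q c
  | d => gen q c ⊗ₜ gen q b + gen q d ⊗ₜ gen q d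

/-- The counit on generators. -/
def counitGen : Gen → ℂ
  | a => 1
  | b => 0
  | c => 0
  | d => 1

/-- The antipode on generators, as an anti-homomorphism. -/
def antipodeGen (q : Circle) : Gen → (SLq q)ᵐᵒᵖ
  | a => .op (gen q d)
  | b => .op (-(q : ℂ)⁻¹ • gen q b)
  | c => .op (-(q : ℂ) • gen q c)
  | d => .op (gen q a)

theorem q_ne_zero : (q : ℂ) ≠ 0 := Circle.coe_ne_zero q

theorem da_eq : gen q d * gen q a = 1 + (q : ℂ)⁻¹ • (gen q b * gen q c) :=
  sub_eq_iff_eq_add.mp rel_da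
theorem ad_eq : gen q a * gen q d = 1 + (q : ℂ) • (gen q b * gen q c) :=
  sub_eq_iff_eq_add.mp rel_ad

variable (q) in
/-- The coproduct of `SL_q(2)`. -/
def comulHom : SLq q →ₐ[ℂ] SLq q ⊗[ℂ] SLq q := by
  refine lift (comulGen q) ?_ ?_ ?_ ?_ ?_ ?_ ?_ <;>
  · have hq := q_ne_zero (q := q)
    simp only [comulGen, mul_add, add_mul, Algebra.TensorProduct.tmul_mul_tmul, rel_ab, rel_ac,
      ← rel_bc, rel_bd, rel_cd, da_eq, ad_eq, TensorProduct.tmul_smul, TensorProduct.tmul_add,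
      TensorProduct.add_tmul, ← TensorProduct.smul_tmul', smul_add, smul_smul,
      Algebra.TensorProduct.one_def]
    match_scalars <;> field_simp <;> ring

variable (q) in
/-- The counit of `SL_q(2)`. -/
def counitHom : SLq q →ₐ[ℂ] ℂ := by
  refine lift counitGen ?_ ?_ ?_ ?_ ?_ ?_ ?_ <;> simp [counitGen]

variable (q) in
/-- The antipode of `SL_q(2)` as an anti-homomorphism. -/
def antipodeHom : SLq q →ₐ[ℂ] (SLq q)ᵐᵒᵖ := by
  refine lift (antipodeGen q) ?_ ?_ ?_ ?_ ?_ ?_ ?_ <;>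
  · have hq := q_ne_zero (q := q)
    apply MulOpposite.unop_injective
    simp only [antipodeGen, MulOpposite.unop_mul, MulOpposite.unop_smul, MulOpposite.unop_op,
      MulOpposite.unop_sub, MulOpposite.unop_one, smul_mul_assoc, mul_smul_comm, rel_ab, rel_ac,
      ← rel_bc, rel_bd, rel_cd, da_eq, ad_eq, smul_smul]
    match_scalars <;> field_simp <;> ring

instance : Bialgebra ℂ (SLq q) :=
  Bialgebra.ofAlgHom (comulHom q) (counitHom q)
    (by
      refine algHom_ext fun x => ?_
      cases x <;>
        simp [comulHom, comulGen, TensorProduct.add_tmul, TensorProduct.tmul_add] <;> abel)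
    (by
      refine algHom_ext fun x => ?_
      cases x <;> simp [comulHom, counitHom, comulGen, counitGen])
    (by
      refine algHom_ext fun x => ?_
      cases x <;> simp [comulHom, counitHom, comulGen, counitGen])

@[simp] theorem comul_gen (g : Gen) : Coalgebra.comul (R := ℂ) (gen q g) = comulGen q g := by
  change comulHom q (gen q g) = _
  simp [comulHom]

@[simp] theorem counit_gen (g : Gen) : Coalgebra.counit (R := ℂ) (gen q g) = counitGen g := by
  change counitHom q (gen q g) = _
  simp [counitHom]

variable (q) in
/-- The antipode of `SL_q(2)` as a linear map. -/
def antipodeLin : SLq q →ₗ[ℂ] SLq q :=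
  (MulOpposite.opLinearEquiv ℂ).symm.toLinearMap ∘ₗ (antipodeHom q).toLinearMap

theorem antipodeLin_gen (g : Gen) : antipodeLin q (gen q g) = (antipodeGen q g).unop := by
  simp [antipodeLin, antipodeHom]

theorem antipodeLin_mul (x y : SLq q) :
    antipodeLin q (x * y) = antipodeLin q y * antipodeLin q x := by
  simp [antipodeLin]

theorem antipodeLin_algebraMap (z : ℂ) :
    antipodeLin q (algebraMap ℂ _ z) = algebraMap ℂ _ z := by
  simp [antipodeLin]

theorem mul_antipode_left_aux (t : SLq q ⊗[ℂ] SLq q) (x y : SLq q) :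
    LinearMap.mul' ℂ _ ((antipodeLin q).rTensor _ (t * x ⊗ₜ y)) =
      antipodeLin q x * LinearMap.mul' ℂ _ ((antipodeLin q).rTensor _ t) * y := by
  induction t with
  | zero => simp
  | tmul u v => simp [antipodeLin_mul, mul_assoc]
  | add u v hu hv => simp [add_mul, mul_add, hu, hv]

theorem mul_antipode_right_aux (t : SLq q ⊗[ℂ] SLq q) (x y : SLq q) :
    LinearMap.mul' ℂ _ ((antipodeLin q).lTensor _ (x ⊗ₜ y * t)) =
      x * LinearMap.mul' ℂ _ ((antipodeLin q).lTensor _ t) * antipodeLin q y := by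
  induction t with
  | zero => simp
  | tmul u v => simp [antipodeLin_mul, mul_assoc]
  | add u v hu hv => simp [add_mul, mul_add, hu, hv]

theorem mul_antipode_left (x : SLq q) :
    LinearMap.mul' ℂ _ ((antipodeLin q).rTensor _ (Coalgebra.comul x)) =
      algebraMap ℂ _ (Coalgebra.counit x) := by
  induction x using induction with
  | hs z => simp [Algebra.TensorProduct.algebraMap_apply, antipodeLin_algebraMap]
  | hg g =>
    have hq := q_ne_zero (q := q)
    cases g <;>
    · simp only [comul_gen, counit_gen, comulGen, counitGen, map_add, LinearMap.rTensor_tmul,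
        LinearMap.mul'_apply, antipodeLin_gen, antipodeGen, MulOpposite.unop_op, smul_mul_assoc,
        rel_ab, rel_ac, ← rel_bc, rel_bd, rel_cd, da_eq, ad_eq, map_one, map_zero]
      match_scalars <;> field_simp <;> ring
  | hm x y hx hy =>
    rw [Bialgebra.comul_mul, Bialgebra.counit_mul, map_mul (algebraMap _ _), ← hy]
    generalize Coalgebra.comul (R := ℂ) y = t
    induction t with
    | zero => simp
    | tmul u v =>
      rw [mul_antipode_left_aux, hx, ← Algebra.commutes, mul_assoc]
      simp
    | add u v hu hv => simp only [mul_add, map_add, hu, hv]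
  | ha x y hx hy => simp [hx, hy]

theorem mul_antipode_right (x : SLq q) :
    LinearMap.mul' ℂ _ ((antipodeLin q).lTensor _ (Coalgebra.comul x)) =
      algebraMap ℂ _ (Coalgebra.counit x) := by
  induction x using induction with
  | hs z =>
    have h1 : antipodeLin q 1 = 1 := by simpa using antipodeLin_algebraMap (q := q) 1
    simp [Algebra.TensorProduct.algebraMap_apply, h1]
  | hg g =>
    have hq := q_ne_zero (q := q)
    cases g <;>
    · simp only [comul_gen, counit_gen, comulGen, counitGen, map_add, LinearMap.lTensor_tmul,
        LinearMap.mul'_apply, antipodeLin_gen, antipodeGen, MulOpposite.unop_op, mul_smul_comm,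
        rel_ab, rel_ac, ← rel_bc, rel_bd, rel_cd, da_eq, ad_eq, map_one, map_zero]
      match_scalars <;> field_simp <;> ring
  | hm x y hx hy =>
    rw [Bialgebra.comul_mul, Bialgebra.counit_mul, map_mul (algebraMap _ _), ← hx]
    generalize Coalgebra.comul (R := ℂ) x = t
    induction t with
    | zero => simp
    | tmul u v =>
      rw [mul_antipode_right_aux, hy, mul_assoc, Algebra.commutes, ← mul_assoc]
      simp
    | add u v hu hv => simp only [add_mul, map_add, hu, hv]
  | ha x y hx hy => simp [hx, hy]

instance : HopfAlgebra ℂ (SLq q) where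
  antipode := antipodeLin q
  mul_antipode_rTensor_comul := LinearMap.ext mul_antipode_left
  mul_antipode_lTensor_comul := LinearMap.ext mul_antipode_right

/-- The conjugate-linear ring homomorphism on the free algebra sending each generator to its
(opposite) image in `SL_q(2)`. -/
def starFree (q : Circle) : FreeAlgebra ℂ Gen →+* (SLq q)ᵐᵒᵖ :=
  (MonoidAlgebra.liftNCRingHom ((algebraMap ℂ (SLq q)ᵐᵒᵖ).comp (starRingEnd ℂ))
    (FreeMonoid.lift fun g => MulOpposite.op (gen q g))
    (fun z _ => Algebra.commutes (conj z) _)).comp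
    (FreeAlgebra.equivMonoidAlgebraFreeMonoid (R := ℂ) (X := Gen)).toRingEquiv.toRingHom

theorem starFree_gen (g : Gen) : starFree q (fr g) = MulOpposite.op (gen q g) := by
  simp only [starFree, fr, FreeAlgebra.equivMonoidAlgebraFreeMonoid, RingHom.comp_apply]
  erw [FreeAlgebra.lift_ι_apply]
  simp [MonoidAlgebra.liftNCRingHom, MonoidAlgebra.liftNC_single]

theorem starFree_algebraMap (z : ℂ) :
    starFree q (algebraMap ℂ _ z) = algebraMap ℂ _ (conj z) := by
  simp [starFree, MonoidAlgebra.liftNCRingHom, MonoidAlgebra.liftNC_single]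

theorem starFree_smul (z : ℂ) (x : FreeAlgebra ℂ Gen) :
    starFree q (z • x) = conj z • starFree q x := by
  rw [Algebra.smul_def, map_mul, starFree_algebraMap, Algebra.smul_def]

/-- The involution as a conjugate-linear anti-homomorphism fixing the generators. -/
def starHom (q : Circle) : SLq q →+* (SLq q)ᵐᵒᵖ :=
  RingQuot.lift ⟨starFree q, by
    have hq := q_ne_zero (q := q)
    intro x y h
    apply MulOpposite.unop_injective
    cases h <;>
    · simp only [map_mul, map_sub, map_one, starFree_smul, starFree_gen, MulOpposite.unop_mul,
        MulOpposite.unop_smul, MulOpposite.unop_op, map_inv₀, ← Circle.coe_inv_eq_conj,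
        Circle.coe_inv, MulOpposite.unop_sub, MulOpposite.unop_one, rel_ab, rel_ac,
        ← rel_bc, rel_bd, rel_cd, da_eq, ad_eq, smul_smul]
      try (match_scalars <;> field_simp <;> ring)⟩

theorem starHom_mk (x : FreeAlgebra ℂ Gen) : starHom q (mk q x) = starFree q x := by
  have : mk q x = RingQuot.mkRingHom (Rel q) x := by
    rw [← RingQuot.mkAlgHom_coe ℂ]; rfl
  rw [this]
  exact RingQuot.lift_mkRingHom_apply ..

theorem starHom_gen (g : Gen) : starHom q (gen q g) = MulOpposite.op (gen q g) :=
  (starHom_mk _).trans (starFree_gen g)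

theorem starHom_algebraMap (z : ℂ) :
    starHom q (algebraMap ℂ _ z) = algebraMap ℂ _ (conj z) := by
  rw [← AlgHom.commutes (mk q), starHom_mk, starFree_algebraMap]

/-- The involution of `SL_q(2, ℝ)`: conjugate linear, anti-multiplicative, with
`a, b, c, d` self-adjoint. -/
instance : StarRing (SLq q) where
  star x := (starHom q x).unop
  star_involutive x := by
    induction x using induction with
    | hs z => simp [starHom_algebraMap]
    | hg g => simp [starHom_gen]
    | hm x y hx hy => simp [hx, hy]
    | ha x y hx hy => simp [hx, hy]
  star_mul x y := by simp
  star_add x y := by simp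

theorem star_def (x : SLq q) : star x = (starHom q x).unop := rfl

@[simp] theorem star_gen (g : Gen) : star (gen q g) = gen q g := by
  simp [star_def, starHom_gen]

instance : StarModule ℂ (SLq q) where
  star_smul z x := by
    rw [Algebra.smul_def, star_mul, star_def (algebraMap _ _ _), starHom_algebraMap,
      Algebra.smul_def]
    simp [Algebra.commutes]

variable (q) in
/-- The conjugate-linear map `τ = * ∘ S`. -/
def tau : SLq q →ₛₗ[starRingEnd ℂ] SLq q where
  toFun x := star (HopfAlgebra.antipode ℂ x)
  map_add' x y := by simp
  map_smul' z x := by simp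

theorem tau_mul (x y : SLq q) : tau q (x * y) = tau q x * tau q y := by
  change star (antipodeLin q (x * y)) = star (antipodeLin q x) * star (antipodeLin q y)
  rw [antipodeLin_mul, star_mul]

theorem tau_gen (g : Gen) : tau q (gen q g) = star (antipodeGen q g).unop :=
  congrArg star (antipodeLin_gen g)

end SLq

/-! ### The coisotropic subgroups `K_{μν}`

`s` is a chosen square root `q^{1/2}` of `q = s ^ 2`. -/

open SLq

/-- The element `a - d + 2 q^{1/2} μ b`. -/
def coisoGen₁ (s : Circle) (μ : ℝ) : SLq (s ^ 2) :=
  gen _ a - gen _ d + (2 * (s : ℂ) * (μ : ℂ)) • gen _ b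

/-- The element `q ν b + c`. -/
def coisoGen₂ (s : Circle) (ν : ℝ) : SLq (s ^ 2) :=
  (((s ^ 2 : Circle) : ℂ) * (ν : ℂ)) • gen _ b + gen _ c

/-- The coideal `C_{μν}`. -/
def coisoSpan (s : Circle) (μ ν : ℝ) : Submodule ℂ (SLq (s ^ 2)) :=
  Submodule.span ℂ {coisoGen₁ s μ, coisoGen₂ s ν}

/-- The right ideal `R_{μν} = C_{μν} · SL_q(2, ℝ)`. -/
def coisoIdeal (s : Circle) (μ ν : ℝ) : Submodule ℂ (SLq (s ^ 2)) :=
  coisoSpan s μ ν * ⊤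

theorem coisoGen₁_mul_mem (s : Circle) (μ ν : ℝ) (x : SLq (s ^ 2)) :
    coisoGen₁ s μ * x ∈ coisoIdeal s μ ν :=
  Submodule.mul_mem_mul (Submodule.subset_span (by simp)) trivial

theorem coisoGen₂_mul_mem (s : Circle) (μ ν : ℝ) (x : SLq (s ^ 2)) :
    coisoGen₂ s ν * x ∈ coisoIdeal s μ ν :=
  Submodule.mul_mem_mul (Submodule.subset_span (by simp)) trivial

/-- To check inclusion of the right ideal it is enough to check multiples of its generators. -/
theorem coisoIdeal_le {s : Circle} {μ ν : ℝ} {N : Submodule ℂ (SLq (s ^ 2))}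
    (h₁ : ∀ x, coisoGen₁ s μ * x ∈ N) (h₂ : ∀ x, coisoGen₂ s ν * x ∈ N) :
    coisoIdeal s μ ν ≤ N := by
  refine Submodule.mul_le.mpr fun m hm x _ => ?_
  induction hm using Submodule.span_induction with
  | mem m hm => rcases hm with rfl | rfl <;> simp [h₁, h₂]
  | zero => simp
  | add m m' _ _ hm hm' => rw [add_mul]; exact N.add_mem hm hm'
  | smul z m _ hm => rw [smul_mul_assoc]; exact N.smul_mem z hm

theorem comul_coisoGen₁ (s : Circle) (μ ν : ℝ) :
    Coalgebra.comul (R := ℂ) (coisoGen₁ s μ) =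
      coisoGen₁ s μ ⊗ₜ (gen _ a + (2 * (s : ℂ) * (μ : ℂ)) • gen _ b) +
      (gen _ d - (2 * (s : ℂ) * (μ : ℂ)) • gen _ b) ⊗ₜ coisoGen₁ s μ +
      gen _ b ⊗ₜ coisoGen₂ s ν - coisoGen₂ s ν ⊗ₜ gen _ b := by
  simp only [coisoGen₁, coisoGen₂, map_add, map_sub, map_smul, comul_gen, comulGen,
    TensorProduct.add_tmul, TensorProduct.tmul_add, TensorProduct.sub_tmul,
    TensorProduct.tmul_sub, ← TensorProduct.smul_tmul', TensorProduct.tmul_smul]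
  module

theorem comul_coisoGen₂ (s : Circle) (μ ν : ℝ) :
    Coalgebra.comul (R := ℂ) (coisoGen₂ s ν) =
      (gen _ a + (2 * (s : ℂ) * (μ : ℂ)) • gen _ b) ⊗ₜ coisoGen₂ s ν +
      coisoGen₂ s ν ⊗ₜ (gen _ d - (2 * (s : ℂ) * (μ : ℂ)) • gen _ b) -
      coisoGen₁ s μ ⊗ₜ gen _ c + gen _ c ⊗ₜ coisoGen₁ s μ := by
  simp only [coisoGen₁, coisoGen₂, map_add, map_sub, map_smul, comul_gen, comulGen,
    TensorProduct.add_tmul, TensorProduct.tmul_add, TensorProduct.sub_tmul,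
    TensorProduct.tmul_sub, ← TensorProduct.smul_tmul', TensorProduct.tmul_smul]
  module

/-- The right ideal `R_{μν}` is a two-sided coideal. -/
instance (s : Circle) (μ ν : ℝ) : (coisoIdeal s μ ν).IsCoideal where
  counit_eq_zero := by
    refine coisoIdeal_le (N := LinearMap.ker (Coalgebra.counit (R := ℂ))) ?_ ?_ <;> intro x
    · simp [coisoGen₁, counitGen]
    · simp [coisoGen₂, counitGen]
  map_mkQ_comul_eq_zero := by
    have k₁ : ∀ x, (coisoIdeal s μ ν).mkQ (coisoGen₁ s μ * x) = 0 := fun x =>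
      (Submodule.Quotient.mk_eq_zero _).mpr (coisoGen₁_mul_mem s μ ν x)
    have k₂ : ∀ x, (coisoIdeal s μ ν).mkQ (coisoGen₂ s ν * x) = 0 := fun x =>
      (Submodule.Quotient.mk_eq_zero _).mpr (coisoGen₂_mul_mem s μ ν x)
    refine coisoIdeal_le (N := LinearMap.ker ((TensorProduct.map (coisoIdeal s μ ν).mkQ
      (coisoIdeal s μ ν).mkQ) ∘ₗ Coalgebra.comul)) ?_ ?_ <;> intro x
    · rw [LinearMap.mem_ker, LinearMap.comp_apply, Bialgebra.comul_mul, comul_coisoGen₁ s μ ν]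
      generalize Coalgebra.comul (R := ℂ) x = t
      induction t with
      | zero => simp
      | tmul u v =>
        simp only [add_mul, sub_mul, Algebra.TensorProduct.tmul_mul_tmul, map_add, map_sub,
          TensorProduct.map_tmul, k₁, k₂, TensorProduct.tmul_zero, TensorProduct.zero_tmul]
        simp
      | add u v hu hv => rw [mul_add, map_add, hu, hv, add_zero]
    · rw [LinearMap.mem_ker, LinearMap.comp_apply, Bialgebra.comul_mul, comul_coisoGen₂ s μ ν]
      generalize Coalgebra.comul (R := ℂ) x = t
      induction t with
      | zero => simp
      | tmul u v =>
        simp only [add_mul, sub_mul, Algebra.TensorProduct.tmul_mul_tmul, map_add, map_sub,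
          TensorProduct.map_tmul, k₁, k₂, TensorProduct.tmul_zero, TensorProduct.zero_tmul]
        simp
      | add u v hu hv => rw [mul_add, map_add, hu, hv, add_zero]

/-- The coalgebra `K_{μν} = SL_q(2, ℝ) / R_{μν}`, with the quotient coalgebra structure. -/
abbrev K (s : Circle) (μ ν : ℝ) : Type := SLq (s ^ 2) ⧸ coisoIdeal s μ ν

/-- The quotient map `r_{μν}`. -/
abbrev r (s : Circle) (μ ν : ℝ) : SLq (s ^ 2) →ₗ[ℂ] K s μ ν := (coisoIdeal s μ ν).mkQ

theorem tau_coisoGen₁ (s : Circle) (μ : ℝ) :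
    tau _ (coisoGen₁ s μ) = - coisoGen₁ s μ := by
  have hs := q_ne_zero (q := s)
  simp only [coisoGen₁, map_add, map_sub, map_smulₛₗ, tau_gen, antipodeGen, MulOpposite.unop_op,
    star_gen, star_smul, RCLike.star_def, map_mul, map_neg, map_pow, map_inv₀, ← Circle.coe_inv_eq_conj,
    Circle.coe_inv, Circle.coe_pow, Complex.conj_ofReal, map_ofNat]
  match_scalars <;> field_simp

theorem tau_coisoGen₂ (s : Circle) (ν : ℝ) :
    tau _ (coisoGen₂ s ν) = (-((s ^ 2 : Circle) : ℂ)⁻¹) • coisoGen₂ s ν := by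
  have hs := q_ne_zero (q := s)
  simp only [coisoGen₂, map_add, map_sub, map_smulₛₗ, tau_gen, antipodeGen, MulOpposite.unop_op,
    star_gen, star_smul, RCLike.star_def, map_mul, map_neg, map_pow, map_inv₀, ← Circle.coe_inv_eq_conj,
    Circle.coe_inv, Circle.coe_pow, Complex.conj_ofReal, map_ofNat]
  match_scalars <;> field_simp

theorem tau_coisoIdeal (s : Circle) (μ ν : ℝ) :
    coisoIdeal s μ ν ≤ (coisoIdeal s μ ν).comap (tau (s ^ 2)) := by
  refine coisoIdeal_le ?_ ?_ <;> intro x <;> rw [Submodule.mem_comap, tau_mul]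
  · rw [tau_coisoGen₁, neg_mul]
    exact neg_mem (coisoGen₁_mul_mem s μ ν _)
  · rw [tau_coisoGen₂, smul_mul_assoc]
    exact Submodule.smul_mem _ _ (coisoGen₂_mul_mem s μ ν _)

/-- The conjugate-linear map `τ` induced on `K_{μν}`, so that `τ ∘ r = r ∘ τ`. -/
def tauK (s : Circle) (μ ν : ℝ) : K s μ ν →ₛₗ[starRingEnd ℂ] K s μ ν :=
  Submodule.mapQ _ _ (tau (s ^ 2)) (tau_coisoIdeal s μ ν)

/-! ### The coalgebra `R_q` of the special series `μ² = ν` -/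

/-- The coalgebra `R_q = K_{μν}` with `ν = μ²`. -/
abbrev Rq (s : Circle) (μ : ℝ) : Type := K s μ (μ ^ 2)

/-- The `q`-number `[n]_q`. -/
def qNum (q : ℂ) (n : ℕ) : ℂ := (q ^ n - (q ^ n)⁻¹) / (q - q⁻¹)

/-- The `q`-factorial `[n]_q!`. -/
def qFact (q : ℂ) (n : ℕ) : ℂ := ∏ i ∈ Finset.range n, qNum q (i + 1)

/-- `w_n = (a + q^{1/2} μ b) (a + q^{3/2} μ b) ⋯ (a + q^{n-1/2} μ b)`. -/
def w (s : Circle) (μ : ℝ) : ℕ → SLq (s ^ 2)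
  | 0 => 1
  | n + 1 => w s μ n * (gen _ a + ((s : ℂ) ^ (2 * n + 1) * (μ : ℂ)) • gen _ b)

/-- `v_n = r[w_n]`. -/
def v (s : Circle) (μ : ℝ) (n : ℕ) : Rq s μ := r s μ (μ ^ 2) (w s μ n)

/-- `X_n = ∑_{i=1}^n (q - q⁻¹)^{i-1} q^{i/2} μ^i [n-1]_q! / ([i]_q [n-i]_q!) v_{n-i} · b^i`,
for `n ≥ 1`; the right action on the quotient is `r[x] · y = r[x y]`. -/
def X (s : Circle) (μ : ℝ) (n : ℕ) : Rq s μ :=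
  ∑ i ∈ Finset.Icc 1 n,
    (((s : ℂ) ^ 2 - ((s : ℂ) ^ 2)⁻¹) ^ (i - 1) * (s : ℂ) ^ i * (μ : ℂ) ^ i *
        qFact ((s : ℂ) ^ 2) (n - 1) /
      (qNum ((s : ℂ) ^ 2) i * qFact ((s : ℂ) ^ 2) (n - i))) •
      r s μ (μ ^ 2) (w s μ (n - i) * gen _ b ^ i)

/-- The subspaces `R_q^{(0)} = Span {v_0}` and `R_q^{(n)} = Span {v_n, X_n}` for `n > 0`. -/
def component (s : Circle) (μ : ℝ) (n : ℕ) : Submodule ℂ (Rq s μ) :=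
  if n = 0 then Submodule.span ℂ {v s μ 0} else Submodule.span ℂ {v s μ n, X s μ n}

end QuantumSL2

/-! ### Subcoalgebras and corepresentations -/

section Coalg

variable {C : Type*} [AddCommGroup C] [Module ℂ C] [Coalgebra ℂ C]

/-- `D` is a subcoalgebra: `Δ D ⊆ D ⊗ D`. -/
def IsSubcoalgebra (D : Submodule ℂ C) : Prop :=
  ∀ x ∈ D, Coalgebra.comul (R := ℂ) x ∈ LinearMap.range (TensorProduct.map D.subtype D.subtype)

/-- `D` is a cocommutative subcoalgebra. -/
def IsCocommSubcoalgebra (D : Submodule ℂ C) : Prop :=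
  IsSubcoalgebra D ∧
    ∀ x ∈ D, TensorProduct.comm ℂ C C (Coalgebra.comul x) = Coalgebra.comul (R := ℂ) x

/-- `D` is a simple subcoalgebra: nonzero, with no subcoalgebras other than `0` and `D`. -/
def IsSimpleSubcoalgebra (D : Submodule ℂ C) : Prop :=
  IsSubcoalgebra D ∧ D ≠ ⊥ ∧ ∀ E : Submodule ℂ C, IsSubcoalgebra E → E ≤ D → E = ⊥ ∨ E = D

variable (C) in
/-- A coalgebra is pointed if all its simple subcoalgebras are one dimensional. -/
def IsPointedCoalgebra : Prop :=
  ∀ D : Submodule ℂ C, IsSimpleSubcoalgebra D → Module.finrank ℂ D = 1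

/-- A (right) corepresentation of `C` on `V`. -/
structure IsCorepresentation {V : Type*} [AddCommGroup V] [Module ℂ V]
    (ρ : V →ₗ[ℂ] V ⊗[ℂ] C) : Prop where
  coassoc : ∀ x, TensorProduct.assoc ℂ V C C (ρ.rTensor C (ρ x)) =
    (Coalgebra.comul (R := ℂ) (A := C)).lTensor V (ρ x)
  counit : ∀ x, TensorProduct.rid ℂ V ((Coalgebra.counit (R := ℂ) (A := C)).lTensor V (ρ x)) = x

/-- The matrix coefficient `⟨y, x₍₀₎⟩ x₍₁₎`, where `ρ x = x₍₀₎ ⊗ x₍₁₎`. -/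
def matrixCoeff {V : Type*} [NormedAddCommGroup V] [InnerProductSpace ℂ V]
    (ρ : V →ₗ[ℂ] V ⊗[ℂ] C) (y x : V) : C :=
  TensorProduct.lid ℂ C ((innerₛₗ ℂ y).rTensor C (ρ x))

/-- A corepresentation on an inner product space is unitary with respect to the real structure
`τ` if `τ(ρ_{ij}) = ρ_{ji}` for its matrix coefficients; when `τ = * ∘ S` comes from an involution
this is the usual condition `S(ρ_{ij}) = (ρ_{ji})^*`. -/
structure IsUnitaryCorepresentation (τ : C →ₛₗ[starRingEnd ℂ] C) {V : Type*}
    [NormedAddCommGroup V] [InnerProductSpace ℂ V] (ρ : V →ₗ[ℂ] V ⊗[ℂ] C) : Prop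
    extends IsCorepresentation ρ where
  unitary : ∀ x y, τ (matrixCoeff ρ x y) = matrixCoeff ρ y x

/-- The linear map `ℂ → ℂ ⊗ C`, `z ↦ z ⊗ g`; for `g` group-like it is the one-dimensional
corepresentation attached to `g`. -/
def oneDimCorep (g : C) : ℂ →ₗ[ℂ] ℂ ⊗[ℂ] C := (TensorProduct.mk ℂ ℂ C).flip g

end Coalg

end

/-!
Every functional `Y` on a coalgebra acts by `x ↦ x₍₁₎ Y(x₍₂₎)`, and this operator `D` is compatible
with the comultiplication: `Δ ∘ D = (id ⊗ D) ∘ Δ`. The coideal `C` is annihilated by an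
`(ε, χ)`-derivation `Y` of `SL_q(2)`, where `χ` is the character `a ↦ q⁻¹`, `d ↦ q`; hence `Y`
descends to `R_q`. Each `v_n` is group-like, thus an eigenvector of `D`, and its eigenvalue `λ_n` is
proportional to `q^n + q^{-n} - 2`, so that these eigenvalues are distinct because `q` is not a root
of unity. The sum defining `X_n` telescopes under `D`, which gives `D X_n = λ_n X_n + κ v_n` with
`κ ≠ 0`. So `Span {v_n, X_n}` is a Jordan block of `D`. A dimension count in each degree shows that
these blocks span `R_q`, and they are therefore its generalized eigenspaces.

The rest is read off from `D`. The tensor `Δ X_n - v_n ⊗ X_n - X_n ⊗ v_n` is killed by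
`id ⊗ (D - λ_n)` and by `id ⊗ ε`, hence vanishes. A subcoalgebra is stable under `D`, so it contains
an eigenvector, that is, some `v_n`. Finally, in a Hopf algebra translation by a group-like carries
elements primitive over one group-like to elements primitive over any other one, whereas `v_1` has
the nonzero primitive `X_1` and `v_0` has none.
-/

section LinearAlgebra

open Module.End Polynomial

theorem sup_eq_of_disjoint_of_finrank_le {F V : Type*} [DivisionRing F] [AddCommGroup V]
    [Module F V] {p q r : Submodule F V} [FiniteDimensional F r] (hpq : Disjoint p q)
    (hp : p ≤ r) (hq : q ≤ r)
    (hr : Module.finrank F r ≤ Module.finrank F p + Module.finrank F q) : p ⊔ q = r := by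
  have := Submodule.finiteDimensional_of_le hp
  have := Submodule.finiteDimensional_of_le hq
  refine Submodule.eq_of_le_of_finrank_le (sup_le hp hq) ?_
  rwa [← add_zero (Module.finrank F ↥(p ⊔ q)), ← finrank_bot F V, ← hpq.eq_bot,
    Submodule.finrank_sup_add_finrank_inf_eq]

theorem eq_zero_of_lTensor_eq_zero {R M V W W' : Type*} [CommRing R] [AddCommGroup M] [Module R M]
    [Module.Flat R M] [AddCommGroup V] [Module R V] [AddCommGroup W] [Module R W]
    [AddCommGroup W'] [Module R W'] {f : V →ₗ[R] W} {g : V →ₗ[R] W'}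
    (hfg : ∀ x, f x = 0 → g x = 0 → x = 0) {t : M ⊗[R] V} (hf : f.lTensor M t = 0)
    (hg : g.lTensor M t = 0) : t = 0 := by
  have hinj : Function.Injective (f.prod g) :=
    (injective_iff_map_eq_zero _).mpr fun x hx =>
      hfg x (congrArg Prod.fst hx) (congrArg Prod.snd hx)
  refine (injective_iff_map_eq_zero _).mp
    (Module.Flat.lTensor_preserves_injective_linearMap (M := M) _ hinj) t ?_
  have hprod : f.prod g = LinearMap.inl R W W' ∘ₗ f + LinearMap.inr R W W' ∘ₗ g := by
    ext x <;> simp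
  rw [hprod, LinearMap.lTensor_add, LinearMap.lTensor_comp, LinearMap.lTensor_comp,
    LinearMap.add_apply, LinearMap.comp_apply, LinearMap.comp_apply, hf, hg, map_zero, map_zero,
    add_zero]

section EigenvectorInStableSubmodule

variable {R V : Type*} [CommRing R] [AddCommGroup V] [Module R V] {f : Module.End R V}

theorem exists_aeval_prod_X_sub_C_apply_eq_zero {x : V} (hx : x ∈ ⨆ t, f.maxGenEigenspace t) :
    ∃ m : Multiset R, aeval f (m.map fun t => X - C t).prod x = 0 := by
  induction hx using Submodule.iSup_induction' with
  | mem t x hx =>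
    obtain ⟨k, hk⟩ := (mem_maxGenEigenspace f t x).mp hx
    exact ⟨Multiset.replicate k t, by simpa [Algebra.algebraMap_eq_smul_one] using hk⟩
  | zero => exact ⟨0, by simp⟩
  | add x y _ _ hx hy =>
    obtain ⟨m, hm⟩ := hx
    obtain ⟨m', hm'⟩ := hy
    refine ⟨m + m', ?_⟩
    rw [Multiset.map_add, Multiset.prod_add, map_add]
    nth_rewrite 1 [mul_comm]
    simp only [map_mul, mul_apply, hm, hm', map_zero, add_zero]

theorem exists_eigenvector_mem_of_iSup_maxGenEigenspace_eq_top
    (hf : ⨆ t, f.maxGenEigenspace t = ⊤) {p : Submodule R V} (hp : p ≠ ⊥)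
    (hfp : ∀ x ∈ p, f x ∈ p) : ∃ t, ∃ x ∈ p, f.HasEigenvector t x := by
  obtain ⟨x, hxp, hx0⟩ := p.exists_mem_ne_zero_of_ne_bot hp
  obtain ⟨m, hm⟩ := exists_aeval_prod_X_sub_C_apply_eq_zero (hf ▸ Submodule.mem_top : x ∈ _)
  induction m using Multiset.induction generalizing x with
  | empty => exact absurd (by simpa using hm) hx0
  | cons t m ih =>
    by_cases hx : f x = t • x
    · exact ⟨t, x, hxp, mem_eigenspace_iff.mpr hx, hx0⟩
    · refine ih (f x - t • x) (p.sub_mem (hfp x hxp) (p.smul_mem t hxp)) (sub_ne_zero.mpr hx) ?_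
      rw [Multiset.map_cons, Multiset.prod_cons, mul_comm, map_mul, mul_apply] at hm
      simpa using hm

end EigenvectorInStableSubmodule

section JordanPair

variable {F V : Type*} [Field F] [AddCommGroup V] [Module F V] {f : Module.End F V} {t c : F}
  {v x : V}

theorem maxGenEigenspace_eq_iSup_of_le {ι : Type*} {p : ι → Submodule F V} {l : ι → F}
    (hp : ∀ i, p i ≤ f.maxGenEigenspace (l i)) (htop : ⨆ i, p i = ⊤) (t : F) :
    f.maxGenEigenspace t = ⨆ (i) (_ : l i = t), p i := by
  refine (congrFun (((independent_maxGenEigenspace f).le_iff_eq_of_iSup_eq_top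
    (f := fun t => ⨆ (i) (_ : l i = t), p i) ?_).mp fun t => ?_) t).symm
  · rw [iSup_comm]
    simpa using htop
  · exact iSup₂_le fun i hi => hi ▸ hp i

theorem mem_maxGenEigenspace_of_apply_eq (hv : f v = t • v) (hx : f x = t • x + c • v) :
    x ∈ f.maxGenEigenspace t :=
  (mem_maxGenEigenspace f t x).mpr ⟨2, by simp [pow_two, hv, hx]⟩

theorem linearIndependent_pair_of_apply_eq (hv : f v = t • v) (hx : f x = t • x + c • v)
    (hv₀ : v ≠ 0) (hc : c ≠ 0) : LinearIndependent F ![v, x] := by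
  refine LinearIndependent.pair_iff.mpr fun k l h => ?_
  have hl : (l * c) • v = 0 := by
    have := congrArg (fun y => f y - t • y) h
    simp only [map_add, map_smul, hv, hx, map_zero, smul_zero, sub_zero] at this
    rw [← this]
    module
  obtain rfl : l = 0 := by simpa [hv₀, hc] using hl
  exact ⟨by simpa [hv₀] using h, rfl⟩

theorem mem_span_singleton_of_mem_span_pair_of_apply_eq (hv : f v = t • v)
    (hx : f x = t • x + c • v) (hv₀ : v ≠ 0) (hc : c ≠ 0) {y : V} (hy : f y = t • y)
    (hmem : y ∈ Submodule.span F {v, x}) : y ∈ Submodule.span F {v} := by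
  obtain ⟨k, l, rfl⟩ := Submodule.mem_span_pair.mp hmem
  have hl : (l * c) • v = 0 := by
    rw [← sub_eq_zero.mpr hy]
    simp only [map_add, map_smul, hv, hx]
    module
  obtain rfl : l = 0 := by simpa [hv₀, hc] using hl
  simpa using Submodule.smul_mem _ k (Submodule.mem_span_singleton_self v)

end JordanPair

end LinearAlgebra

section Coalgebra

open Coalgebra

section Hit

variable {R C D : Type*} [CommSemiring R] [AddCommMonoid C] [Module R C] [Coalgebra R C]
  [AddCommMonoid D] [Module R D] [Coalgebra R D]

/-- The left action `f ⇀ x = x₍₁₎ f(x₍₂₎)` of the linear functionals on a coalgebra. -/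
noncomputable def hit (f : C →ₗ[R] R) : C →ₗ[R] C :=
  (TensorProduct.rid R C).toLinearMap ∘ₗ f.lTensor C ∘ₗ comul

theorem hit_apply (f : C →ₗ[R] R) (x : C) :
    hit f x = TensorProduct.rid R C (f.lTensor C (comul x)) := rfl

theorem hit_eq_of_isGroupLikeElem (f : C →ₗ[R] R) {g : C} (hg : IsGroupLikeElem R g) :
    hit f g = f g • g := by
  simp [hit_apply, hg.comul_eq_tmul_self]

theorem comul_hit (f : C →ₗ[R] R) (x : C) : comul (hit f x) = (hit f).lTensor C (comul x) := by
  have comul_slice (t : C ⊗[R] C) : comul (TensorProduct.rid R C (f.lTensor C t)) =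
      ((TensorProduct.rid R C).toLinearMap ∘ₗ f.lTensor C).lTensor C
        (TensorProduct.assoc R C C C (comul.rTensor C t)) := by
    induction t with
    | zero => simp
    | add u v hu hv => simp only [map_add, hu, hv]
    | tmul x y =>
      simp only [LinearMap.lTensor_tmul, TensorProduct.rid_tmul, map_smul, LinearMap.rTensor_tmul]
      generalize comul (R := R) x = u
      induction u with
      | zero => simp
      | add u v hu hv => simp only [smul_add, TensorProduct.add_tmul, map_add, hu, hv]
      | tmul x z => simp
  rw [hit_apply, comul_slice, coassoc_apply, hit, ← LinearMap.comp_assoc,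
    LinearMap.lTensor_comp _ _ comul, LinearMap.comp_apply]

theorem counit_hit (f : C →ₗ[R] R) (x : C) : counit (hit f x) = f x := by
  have counit_slice (t : C ⊗[R] C) : counit (TensorProduct.rid R C (f.lTensor C t)) =
      f (TensorProduct.lid R C (counit.rTensor C t)) := by
    induction t with
    | zero => simp
    | add u v hu hv => simp only [map_add, hu, hv]
    | tmul x y => simp [mul_comm]
  rw [hit_apply, counit_slice, rTensor_counit_comul, TensorProduct.lid_tmul, one_smul]

theorem hit_map (f : D →ₗ[R] R) (φ : C →ₗc[R] D) (x : C) :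
    hit f (φ x) = φ (hit (f ∘ₗ φ.toLinearMap) x) := by
  rw [hit_apply, hit_apply, ← CoalgHomClass.map_comp_comul_apply]
  generalize comul (R := R) x = t
  induction t with
  | zero => simp
  | add u v hu hv => simp only [map_add, hu, hv]
  | tmul x y => simp

end Hit

theorem hit_mul_of_derivation {R A : Type*} [CommSemiring R] [Semiring A] [Bialgebra R A]
    {Y χ : A →ₗ[R] R} (hY : ∀ x y, Y (x * y) = counit x * Y y + Y x * χ y) (x y : A) :
    hit Y (x * y) = x * hit Y y + hit Y x * hit χ y := by
  have slice (t u : A ⊗[R] A) : TensorProduct.rid R A (Y.lTensor A (t * u)) =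
      TensorProduct.rid R A (counit.lTensor A t) * TensorProduct.rid R A (Y.lTensor A u) +
        TensorProduct.rid R A (Y.lTensor A t) * TensorProduct.rid R A (χ.lTensor A u) := by
    induction t with
    | zero => simp
    | add t₁ t₂ h₁ h₂ => simp only [add_mul, map_add, h₁, h₂]; abel
    | tmul a b =>
      induction u with
      | zero => simp
      | add u₁ u₂ h₁ h₂ => simp only [mul_add, map_add, h₁, h₂]; abel
      | tmul c d => simp [hY, add_smul, smul_smul, mul_comm]
  rw [hit_apply, Bialgebra.comul_mul, slice, lTensor_counit_comul, TensorProduct.rid_tmul, one_smul]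
  rfl

section Primitive

/-- `x` is primitive over the group-like `g`, that is, `(g, g)`-skew-primitive. -/
def IsPrimitiveOver (R : Type*) {C : Type*} [CommSemiring R] [AddCommMonoid C] [Module R C]
    [Coalgebra R C] (g x : C) : Prop :=
  comul x = g ⊗ₜ[R] x + x ⊗ₜ[R] g

theorem IsPrimitiveOver.map {R C D : Type*} [CommSemiring R] [AddCommMonoid C] [Module R C]
    [Coalgebra R C] [AddCommMonoid D] [Module R D] [Coalgebra R D] {g x : C}
    (hx : IsPrimitiveOver R g x) (φ : C →ₗc[R] D) : IsPrimitiveOver R (φ g) (φ x) := by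
  rw [IsPrimitiveOver, ← CoalgHomClass.map_comp_comul_apply, hx, map_add]
  rfl

theorem IsPrimitiveOver.mul_right {R A : Type*} [CommSemiring R] [Semiring A] [Bialgebra R A]
    {g x u : A} (hx : IsPrimitiveOver R g x) (hu : IsGroupLikeElem R u) :
    IsPrimitiveOver R (g * u) (x * u) := by
  rw [IsPrimitiveOver, Bialgebra.comul_mul, hx, hu.comul_eq_tmul_self, add_mul,
    Algebra.TensorProduct.tmul_mul_tmul, Algebra.TensorProduct.tmul_mul_tmul]

theorem IsPrimitiveOver.mul_antipode_mul {R H : Type*} [CommSemiring R] [Semiring H]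
    [HopfAlgebra R H] {g h x : H} (hx : IsPrimitiveOver R h x) (hg : IsGroupLikeElem R g)
    (hh : IsGroupLikeElem R h) :
    IsPrimitiveOver R g (x * (HopfAlgebra.antipode R h * g)) := by
  simpa [← mul_assoc, hh.mul_antipode_cancel] using hx.mul_right (hh.antipode.mul hg)

theorem IsPrimitiveOver.hit_eq {R C : Type*} [CommSemiring R] [AddCommMonoid C] [Module R C]
    [Coalgebra R C] {g x : C} (hx : IsPrimitiveOver R g x) (f : C →ₗ[R] R) :
    hit f x = f g • x + f x • g := by
  rw [hit_apply, hx, add_comm]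
  simp

variable {R C : Type*} [CommRing R] [AddCommGroup C] [Module R C] [Coalgebra R C] {g x : C}

theorem IsPrimitiveOver.counit_eq_zero (hx : IsPrimitiveOver R g x) (hg : IsGroupLikeElem R g) :
    counit (R := R) x = 0 := by
  have hxg : counit (R := R) x • g = 0 := by
    have hcounit : hit (counit (R := R)) x = x := by
      rw [hit_apply, lTensor_counit_comul, TensorProduct.rid_tmul, one_smul]
    rw [hx.hit_eq, hg.counit_eq_one, one_smul] at hcounit
    exact add_eq_left.mp hcounit
  simpa [hg.counit_eq_one] using congrArg (counit (R := R)) hxg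

/-- `Δ x - g ⊗ x - x ⊗ g` is annihilated by `id ⊗ (hit f - f g)` and by `id ⊗ ε`. -/
theorem isPrimitiveOver_of_hit_eq [Module.Flat R C] (hg : IsGroupLikeElem R g) {f : C →ₗ[R] R}
    (hf : ∀ y, hit f y = f g • y → counit (R := R) y = 0 → y = 0)
    (hx : hit f x = f g • x + f x • g) (hε : counit (R := R) x = 0) : IsPrimitiveOver R g x := by
  refine sub_eq_zero.mp (eq_zero_of_lTensor_eq_zero (f := hit f - f g • LinearMap.id)
    (g := counit (R := R)) (fun y hy => hf y (sub_eq_zero.mp hy)) ?_ ?_)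
  · rw [LinearMap.lTensor_sub, LinearMap.lTensor_smul, LinearMap.lTensor_id, LinearMap.sub_apply,
      LinearMap.smul_apply, LinearMap.id_apply, map_sub ((hit f).lTensor C), ← comul_hit, hx]
    simp only [map_add, map_smul, LinearMap.lTensor_tmul, hit_eq_of_isGroupLikeElem f hg, hx,
      hg.comul_eq_tmul_self, TensorProduct.tmul_add, TensorProduct.tmul_smul]
    module
  · simp [hε, hg.counit_eq_one]

theorem isEmpty_hopfAlgebra_coalgEquiv {h : C} (hg : IsGroupLikeElem R g)
    (hg₀ : ∀ y, IsPrimitiveOver R g y → y = 0) (hh : IsGroupLikeElem R h)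
    (hx : IsPrimitiveOver R h x) (hx₀ : x ≠ 0) (H : Type*) [Ring H] [HopfAlgebra R H] :
    IsEmpty (H ≃ₗc[R] C) := by
  refine ⟨fun φ => hx₀ ?_⟩
  have hg' := hg.map φ.symm
  have hh' := hh.map φ.symm
  have hy := (hx.map (φ.symm : C →ₗc[R] H)).mul_antipode_mul hg' hh'
  have hy₀ := hg₀ _ (by simpa using hy.map (φ : H →ₗc[R] C))
  have hunit := (hh'.antipode.mul hg').isUnit
  simpa [hunit.mul_left_eq_zero] using hy₀

end Primitive

section Subcoalgebra

theorem tmul_mem_range_map_subtype {V : Type*} [AddCommGroup V] [Module ℂ V]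
    {D : Submodule ℂ V} {x y : V} (hx : x ∈ D) (hy : y ∈ D) :
    x ⊗ₜ[ℂ] y ∈ LinearMap.range (TensorProduct.map D.subtype D.subtype) :=
  ⟨(⟨x, hx⟩ : D) ⊗ₜ (⟨y, hy⟩ : D), rfl⟩

variable {C : Type*} [AddCommGroup C] [Module ℂ C] [Coalgebra ℂ C] {g x : C}

theorem IsSubcoalgebra.hit_mem {D : Submodule ℂ C} (hD : IsSubcoalgebra D) (f : C →ₗ[ℂ] ℂ)
    (hx : x ∈ D) : hit f x ∈ D := by
  obtain ⟨t, ht⟩ := hD x hx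
  rw [hit_apply, ← ht]
  clear ht
  induction t with
  | zero => simp
  | add u v hu hv => simp only [map_add]; exact D.add_mem hu hv
  | tmul y z => simpa using D.smul_mem _ y.2

theorem isCocommSubcoalgebra_span {S : Set C}
    (hΔ : ∀ x ∈ S, comul (R := ℂ) x ∈ LinearMap.range
      (TensorProduct.map (Submodule.span ℂ S).subtype (Submodule.span ℂ S).subtype))
    (hcomm : ∀ x ∈ S, TensorProduct.comm ℂ C C (comul x) = comul (R := ℂ) x) :
    IsCocommSubcoalgebra (Submodule.span ℂ S) :=
  ⟨fun _ hx => (Submodule.span_le (p := (LinearMap.range (TensorProduct.map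
      (Submodule.span ℂ S).subtype (Submodule.span ℂ S).subtype)).comap comul)).mpr hΔ hx,
    fun _ hx => (Submodule.span_le (p := LinearMap.eqLocus
      ((TensorProduct.comm ℂ C C).toLinearMap ∘ₗ comul) comul)).mpr hcomm hx⟩

theorem isCocommSubcoalgebra_span_of_isGroupLikeElem (hg : IsGroupLikeElem ℂ g) :
    IsCocommSubcoalgebra (Submodule.span ℂ {g}) := by
  refine isCocommSubcoalgebra_span ?_ ?_ <;> rintro _ rfl <;> rw [hg.comul_eq_tmul_self]
  · exact tmul_mem_range_map_subtype (Submodule.mem_span_singleton_self _)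
      (Submodule.mem_span_singleton_self _)
  · rfl

theorem isCocommSubcoalgebra_span_pair (hg : IsGroupLikeElem ℂ g) (hx : IsPrimitiveOver ℂ g x) :
    IsCocommSubcoalgebra (Submodule.span ℂ {g, x}) := by
  have hgmem : g ∈ Submodule.span ℂ {g, x} := Submodule.subset_span (by simp)
  have hxmem : x ∈ Submodule.span ℂ {g, x} := Submodule.subset_span (by simp)
  refine isCocommSubcoalgebra_span ?_ ?_ <;> rintro _ (rfl | rfl)
  · rw [hg.comul_eq_tmul_self]
    exact tmul_mem_range_map_subtype hgmem hgmem
  · rw [hx]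
    exact add_mem (tmul_mem_range_map_subtype hgmem hxmem) (tmul_mem_range_map_subtype hxmem hgmem)
  · rw [hg.comul_eq_tmul_self]
    rfl
  · rw [hx, map_add, add_comm]
    rfl

theorem isSimpleSubcoalgebra_span_of_isGroupLikeElem (hg : IsGroupLikeElem ℂ g) :
    IsSimpleSubcoalgebra (Submodule.span ℂ {g}) :=
  ⟨(isCocommSubcoalgebra_span_of_isGroupLikeElem hg).1,
    Submodule.span_singleton_eq_bot.not.mpr hg.ne_zero,
    fun _ _ hE => (nonzero_span_atom g hg.ne_zero).le_iff.mp hE⟩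

theorem isUnitaryCorepresentation_oneDimCorep (hg : IsGroupLikeElem ℂ g)
    {τ : C →ₛₗ[starRingEnd ℂ] C} (hτ : τ g = g) :
    IsUnitaryCorepresentation τ (oneDimCorep g) where
  coassoc x := by simp [oneDimCorep, hg.comul_eq_tmul_self]
  counit x := by simp [oneDimCorep, hg.counit_eq_one]
  unitary x y := by simp [matrixCoeff, oneDimCorep, hτ, mul_comm]

end Subcoalgebra

end Coalgebra

namespace QuantumSL2

open Gen SLq

namespace SLq

variable {q : Circle} (t : ℂ)

variable (q) in
/-- The first entry `a + t b` of the generating matrix `(a b; c d)` applied to the column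
`(1, t)`. -/
noncomputable def colTop : SLq q := gen q a + t • gen q b

variable (q) in
/-- The second entry `c + t d` of the generating matrix `(a b; c d)` applied to the column
`(1, t)`. -/
noncomputable def colBot : SLq q := gen q c + t • gen q d

theorem colTop_mul_colBot :
    colTop q t * colBot q (q * t) = (q : ℂ) • (colBot q t * colTop q (q * t)) := by
  have hq := q_ne_zero (q := q)
  simp only [colTop, colBot, mul_add, add_mul, mul_smul_comm, smul_mul_assoc, rel_ac, ← rel_bc,
    rel_bd, da_eq, ad_eq]
  match_scalars <;> field_simp

theorem comul_colTop : Coalgebra.comul (R := ℂ) (colTop q t) =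
    gen q a ⊗ₜ colTop q t + gen q b ⊗ₜ colBot q t := by
  simp only [colTop, colBot, map_add, map_smul, comul_gen, comulGen, TensorProduct.tmul_add,
    TensorProduct.tmul_smul]
  module

theorem counit_colTop : Coalgebra.counit (R := ℂ) (colTop q t) = 1 := by
  simp [colTop, counitGen]

theorem tau_one : tau q 1 = 1 := by
  simp [tau]

theorem tau_colTop : tau q (colTop q t) = gen q d - (conj t * q) • gen q b := by
  simp only [colTop, map_add, map_smulₛₗ, tau_gen, antipodeGen, MulOpposite.unop_op, star_gen,
    star_smul, RCLike.star_def, map_neg, map_inv₀, ← Circle.coe_inv_eq_conj, Circle.coe_inv,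
    inv_inv]
  module

end SLq

/-- The right action `k ◃ y` of `SL_q(2)` on `K_{μν}`, written `k · y` in the paper, as a bilinear
map. -/
noncomputable def act {s : Circle} {μ ν : ℝ} : K s μ ν →ₗ[ℂ] SLq (s ^ 2) →ₗ[ℂ] K s μ ν :=
  (coisoIdeal s μ ν).liftQ ((LinearMap.mul ℂ (SLq (s ^ 2))).compr₂ (r s μ ν)) <|
    coisoIdeal_le
      (fun x => LinearMap.ext fun y => (Submodule.Quotient.mk_eq_zero _).mpr <| by
        simpa [mul_assoc] using coisoGen₁_mul_mem s μ ν (x * y))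
      (fun x => LinearMap.ext fun y => (Submodule.Quotient.mk_eq_zero _).mpr <| by
        simpa [mul_assoc] using coisoGen₂_mul_mem s μ ν (x * y))

local notation:73 k:73 " ◃ " y:74 => act k y

section Action

variable {s : Circle} {μ ν : ℝ}

theorem r_act (x y : SLq (s ^ 2)) : r s μ ν x ◃ y = r s μ ν (x * y) := rfl

theorem act_one (k : K s μ ν) : k ◃ 1 = k := by
  obtain ⟨x, rfl⟩ := (coisoIdeal s μ ν).mkQ_surjective k
  exact congrArg (r s μ ν) (mul_one x)

theorem act_mul (k : K s μ ν) (x y : SLq (s ^ 2)) : k ◃ (x * y) = k ◃ x ◃ y := by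
  obtain ⟨z, rfl⟩ := (coisoIdeal s μ ν).mkQ_surjective k
  exact congrArg (r s μ ν) (mul_assoc z x y).symm

theorem tauK_act (k : K s μ ν) (y : SLq (s ^ 2)) :
    tauK s μ ν (k ◃ y) = tauK s μ ν k ◃ tau _ y := by
  obtain ⟨x, rfl⟩ := (coisoIdeal s μ ν).mkQ_surjective k
  exact congrArg (r s μ ν) (tau_mul x y)

/-- The quotient map `r` as a morphism of coalgebras. -/
noncomputable def rCoalgHom (s : Circle) (μ ν : ℝ) : SLq (s ^ 2) →ₗc[ℂ] K s μ ν :=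
  Coalgebra.Quotient.mkQCoalgHom (coisoIdeal s μ ν)

theorem counit_act (k : K s μ ν) (y : SLq (s ^ 2)) : Coalgebra.counit (R := ℂ) (k ◃ y) =
    Coalgebra.counit (R := ℂ) k * Coalgebra.counit (R := ℂ) y := by
  obtain ⟨x, rfl⟩ := (coisoIdeal s μ ν).mkQ_surjective k
  exact Bialgebra.counit_mul x y

theorem comul_act_of_isGroupLikeElem {g : K s μ ν} (hg : IsGroupLikeElem ℂ g)
    (y : SLq (s ^ 2)) : Coalgebra.comul (R := ℂ) (g ◃ y) =
      TensorProduct.map (act g) (act g) (Coalgebra.comul y) := by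
  obtain ⟨x, rfl⟩ := (coisoIdeal s μ ν).mkQ_surjective g
  have map_mul_tmul (t : SLq (s ^ 2) ⊗[ℂ] SLq (s ^ 2)) (y z : SLq (s ^ 2)) :
      TensorProduct.map (r s μ ν) (r s μ ν) (t * y ⊗ₜ z) =
        TensorProduct.map (act.flip y) (act.flip z)
          (TensorProduct.map (r s μ ν) (r s μ ν) t) := by
    induction t with
    | zero => simp
    | add t₁ t₂ h₁ h₂ => simp only [add_mul, map_add, h₁, h₂]
    | tmul t₁ t₂ => rw [Algebra.TensorProduct.tmul_mul_tmul]; rfl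
  have hx : TensorProduct.map (r s μ ν) (r s μ ν) (Coalgebra.comul x) =
      r s μ ν x ⊗ₜ r s μ ν x := hg.comul_eq_tmul_self
  change TensorProduct.map (r s μ ν) (r s μ ν) (Coalgebra.comul (x * y)) = _
  rw [Bialgebra.comul_mul]
  generalize Coalgebra.comul (R := ℂ) y = t
  induction t with
  | zero => simp
  | add t₁ t₂ h₁ h₂ => simp only [mul_add, map_add, h₁, h₂]
  | tmul y z =>
    rw [map_mul_tmul, hx]
    rfl

end Action

section GroupLike

variable (s : Circle) (μ : ℝ) (n : ℕ)

/-- The slope `t_n = q^{n + 1/2} μ` for which `v_{n+1} = v_n · (a + t_n b)`. -/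
noncomputable def slope : ℂ := (s : ℂ) ^ (2 * n + 1) * μ

theorem slope_succ : slope s μ (n + 1) = ((s ^ 2 : Circle) : ℂ) * slope s μ n := by
  rw [slope, slope, Circle.coe_pow]
  ring

theorem slope_ne_zero {μ : ℝ} (hμ : μ ≠ 0) : slope s μ n ≠ 0 :=
  mul_ne_zero (pow_ne_zero _ (Circle.coe_ne_zero s)) (Complex.ofReal_ne_zero.mpr hμ)

theorem v_succ : v s μ (n + 1) = v s μ n ◃ colTop (s ^ 2) (slope s μ n) := rfl

theorem r_coisoGen₁_mul (ν : ℝ) (x : SLq (s ^ 2)) : r s μ ν (coisoGen₁ s μ * x) = 0 :=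
  (Submodule.Quotient.mk_eq_zero _).mpr (coisoGen₁_mul_mem s μ ν x)

theorem r_coisoGen₂_mul (ν : ℝ) (x : SLq (s ^ 2)) : r s μ ν (coisoGen₂ s ν * x) = 0 :=
  (Submodule.Quotient.mk_eq_zero _).mpr (coisoGen₂_mul_mem s μ ν x)

theorem colTop_mul_coisoGen₂ (t : ℂ) (ν : ℝ) : colTop (s ^ 2) t * coisoGen₂ s ν =
    coisoGen₂ s ν * (((s ^ 2 : Circle) : ℂ) • gen (s ^ 2) a + t • gen (s ^ 2) b) := by
  simp only [colTop, coisoGen₂, mul_add, add_mul, mul_smul_comm, smul_mul_assoc, rel_ab, rel_ac,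
    ← rel_bc]
  module

theorem v_act_coisoGen₂ : v s μ n ◃ coisoGen₂ s (μ ^ 2) = 0 := by
  induction n with
  | zero =>
    rw [v, w, r_act, one_mul, ← mul_one (coisoGen₂ s _)]
    exact r_coisoGen₂_mul s μ (μ ^ 2) 1
  | succ n ih =>
    rw [v_succ, ← act_mul, colTop_mul_coisoGen₂, act_mul, ih, map_zero, LinearMap.zero_apply]

theorem v_act_c :
    v s μ n ◃ gen (s ^ 2) c = (-((s : ℂ) ^ 2 * μ ^ 2)) • (v s μ n ◃ gen (s ^ 2) b) := by
  have h := v_act_coisoGen₂ s μ n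
  rw [coisoGen₂, map_add, map_smul, add_comm] at h
  rw [eq_neg_of_add_eq_zero_left h, neg_smul, Circle.coe_pow, Complex.ofReal_pow]

theorem v_zero_act_d : v s μ 0 ◃ gen (s ^ 2) d =
    v s μ 0 ◃ gen (s ^ 2) a + (2 * s * μ : ℂ) • (v s μ 0 ◃ gen (s ^ 2) b) := by
  have h : v s μ 0 ◃ coisoGen₁ s μ = 0 := by
    rw [v, w, r_act, one_mul, ← mul_one (coisoGen₁ s μ)]
    exact r_coisoGen₁_mul s μ (μ ^ 2) 1
  simp only [coisoGen₁, map_add, map_sub, map_smul] at h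
  rw [← sub_eq_zero, ← neg_eq_zero, ← h]
  module

theorem v_act_colBot :
    v s μ n ◃ colBot (s ^ 2) (slope s μ n) = slope s μ n • v s μ (n + 1) := by
  induction n with
  | zero =>
    rw [v_succ]
    simp only [colBot, colTop, map_add, map_smul, v_act_c, v_zero_act_d, slope]
    module
  | succ n ih =>
    rw [slope_succ, v_succ, ← act_mul, colTop_mul_colBot, map_smul, act_mul, ih,
      v_succ s μ (n + 1), slope_succ, map_smul, LinearMap.smul_apply, smul_smul]

theorem v_act_d {μ : ℝ} (hμ : μ ≠ 0) : v s μ n ◃ gen (s ^ 2) d =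
    v s μ (n + 1) + ((s : ℂ) * μ * ((s : ℂ) ^ (2 * n))⁻¹) • (v s μ n ◃ gen (s ^ 2) b) := by
  have hs₀ := Circle.coe_ne_zero s
  have hμ₀ := Complex.ofReal_ne_zero.mpr hμ
  have h := v_act_colBot s μ n
  rw [colBot, map_add, map_smul, v_act_c] at h
  refine smul_right_injective _ (slope_ne_zero s n hμ) ?_
  simp only [smul_add, ← h]
  rw [slope]
  match_scalars <;> field_simp
  ring

theorem isGroupLikeElem_v : IsGroupLikeElem ℂ (v s μ n) := by
  induction n with
  | zero => exact IsGroupLikeElem.one.map (rCoalgHom s μ (μ ^ 2))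
  | succ n ih =>
    refine ⟨?_, ?_⟩
    · rw [v_succ, counit_act, ih.counit_eq_one, counit_colTop, one_mul]
    · calc Coalgebra.comul (v s μ (n + 1))
          = (v s μ n ◃ gen (s ^ 2) a) ⊗ₜ (v s μ n ◃ colTop (s ^ 2) (slope s μ n)) +
              (v s μ n ◃ gen (s ^ 2) b) ⊗ₜ (v s μ n ◃ colBot (s ^ 2) (slope s μ n)) := by
            rw [v_succ, comul_act_of_isGroupLikeElem ih, comul_colTop]
            rfl
        _ = v s μ (n + 1) ⊗ₜ v s μ (n + 1) := by
            rw [v_act_colBot, ← v_succ, TensorProduct.tmul_smul, TensorProduct.smul_tmul',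
              ← TensorProduct.add_tmul, ← map_smul, ← map_add]
            rfl

theorem tauK_v {μ : ℝ} (hμ : μ ≠ 0) : tauK s μ (μ ^ 2) (v s μ n) = v s μ n := by
  induction n with
  | zero => exact congrArg (r s μ (μ ^ 2)) tau_one
  | succ n ih =>
    have hs₀ := Circle.coe_ne_zero s
    have hcoeff : (s : ℂ) * μ * ((s : ℂ) ^ (2 * n))⁻¹ -
        conj (slope s μ n) * ((s ^ 2 : Circle) : ℂ) = 0 := by
      simp only [slope, map_mul, map_pow, Complex.conj_ofReal, ← Circle.coe_inv_eq_conj,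
        Circle.coe_inv, Circle.coe_pow, inv_pow]
      field_simp
      ring
    rw [v_succ, tauK_act, ih, tau_colTop, map_sub, map_smul, v_act_d s n hμ, ← v_succ,
      add_sub_assoc, ← sub_smul, hcoeff, zero_smul, add_zero]

end GroupLike

section Derivation

/-- The character `χ` of `SL_q(2)` with `a ↦ q⁻¹`, `d ↦ q` and `b, c ↦ 0`. -/
noncomputable def torusChar (q : Circle) : SLq q →ₐ[ℂ] ℂ := by
  refine lift (fun | a => (q : ℂ)⁻¹ | b => 0 | c => 0 | d => (q : ℂ)) ?_ ?_ ?_ ?_ ?_ ?_ ?_ <;> simp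

variable (s : Circle) (μ : ℝ)

/-- The values on the generators of the `(ε, χ)`-derivation `skewDeriv`. Up to a scalar, they are
determined by the relations of `SL_q(2)` and by the vanishing of the derivation on
`a - d + 2 q^{1/2} μ b` and `q μ² b + c`. -/
noncomputable def skewDerivGen : Gen → ℂ
  | a => -(2 * (s : ℂ) * μ)
  | b => 1 + (s : ℂ) ^ 2
  | c => -((s : ℂ) ^ 2 * (μ : ℂ) ^ 2 * (1 + (s : ℂ) ^ 2))
  | d => 2 * (s : ℂ) ^ 3 * μ

/-- The triangular representation `x ↦ (ε(x), Y(x); 0, χ(x))` of `SL_q(2)`; that it is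
multiplicative says that `Y` is an `(ε, χ)`-derivation. -/
noncomputable def triangularRep : SLq (s ^ 2) →ₐ[ℂ] Matrix (Fin 2) (Fin 2) ℂ := by
  refine lift (fun g => !![counitGen g, skewDerivGen s μ g; 0, torusChar (s ^ 2) (gen (s ^ 2) g)])
    ?_ ?_ ?_ ?_ ?_ ?_ ?_ <;>
  · have hs := q_ne_zero (q := s)
    ext i j
    fin_cases i <;> fin_cases j <;> simp [torusChar, counitGen, skewDerivGen] <;> field_simp <;>
      ring

/-- The `(ε, χ)`-derivation `Y` of `SL_q(2)` that annihilates the coideal `C_{μν}`, `ν = μ²`. -/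
noncomputable def skewDeriv : SLq (s ^ 2) →ₗ[ℂ] ℂ :=
  Matrix.entryLinearMap ℂ ℂ 0 1 ∘ₗ (triangularRep s μ).toLinearMap

theorem skewDeriv_gen (g : Gen) : skewDeriv s μ (gen (s ^ 2) g) = skewDerivGen s μ g := by
  simp [skewDeriv, triangularRep]

theorem triangularRep_apply (x : SLq (s ^ 2)) : triangularRep s μ x =
    !![Coalgebra.counit (R := ℂ) x, skewDeriv s μ x; 0, torusChar (s ^ 2) x] := by
  suffices h : triangularRep s μ x 0 0 = Coalgebra.counit (R := ℂ) x ∧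
      triangularRep s μ x 1 0 = 0 ∧ triangularRep s μ x 1 1 = torusChar (s ^ 2) x by
    ext i j
    fin_cases i <;> fin_cases j
    exacts [h.1, rfl, h.2.1, h.2.2]
  induction x using SLq.induction with
  | hs z => simp [Matrix.algebraMap_matrix_apply]
  | hg g => simp [triangularRep]
  | hm x y hx hy => simp [Matrix.mul_apply, Fin.sum_univ_two, hx, hy]
  | ha x y hx hy => simp [hx, hy]

theorem skewDeriv_mul (x y : SLq (s ^ 2)) : skewDeriv s μ (x * y) =
    Coalgebra.counit (R := ℂ) x * skewDeriv s μ y + skewDeriv s μ x * torusChar (s ^ 2) y := by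
  change triangularRep s μ (x * y) 0 1 = _
  simp [triangularRep_apply s μ x, triangularRep_apply s μ y]

/-- The functional induced on `R_q` by the derivation `Y`. -/
noncomputable def skewDerivK : Rq s μ →ₗ[ℂ] ℂ :=
  (coisoIdeal s μ (μ ^ 2)).liftQ (skewDeriv s μ) <| by
    have hgen₁ : skewDeriv s μ (coisoGen₁ s μ) = 0 := by
      simp only [coisoGen₁, map_add, map_sub, map_smul, skewDeriv_gen, skewDerivGen, smul_eq_mul]
      ring
    have hgen₂ : skewDeriv s μ (coisoGen₂ s (μ ^ 2)) = 0 := by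
      simp only [coisoGen₂, map_add, map_smul, skewDeriv_gen, skewDerivGen, smul_eq_mul,
        Circle.coe_pow, Complex.ofReal_pow]
      ring
    refine coisoIdeal_le (fun x => ?_) (fun x => ?_) <;> rw [LinearMap.mem_ker, skewDeriv_mul]
    · rw [hgen₁]
      simp [coisoGen₁, counitGen]
    · rw [hgen₂]
      simp [coisoGen₂, counitGen]

variable {s μ}

theorem skewDerivK_act (k : Rq s μ) (y : SLq (s ^ 2)) : skewDerivK s μ (k ◃ y) =
    Coalgebra.counit (R := ℂ) k * skewDeriv s μ y + skewDerivK s μ k * torusChar (s ^ 2) y := by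
  obtain ⟨x, rfl⟩ := (coisoIdeal s μ (μ ^ 2)).mkQ_surjective k
  exact skewDeriv_mul s μ x y

theorem hit_skewDerivK_act (k : Rq s μ) (y : SLq (s ^ 2)) : hit (skewDerivK s μ) (k ◃ y) =
    k ◃ hit (skewDeriv s μ) y +
      hit (skewDerivK s μ) k ◃ hit (torusChar (s ^ 2)).toLinearMap y := by
  obtain ⟨x, rfl⟩ := (coisoIdeal s μ (μ ^ 2)).mkQ_surjective k
  have hit_r (z : SLq (s ^ 2)) : hit (skewDerivK s μ) (r s μ (μ ^ 2) z) =
      r s μ (μ ^ 2) (hit (skewDeriv s μ) z) := hit_map (skewDerivK s μ) (rCoalgHom s μ (μ ^ 2)) z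
  rw [r_act, hit_r, hit_r, hit_mul_of_derivation (χ := (torusChar (s ^ 2)).toLinearMap)
    (skewDeriv_mul s μ), map_add]
  rfl

theorem hit_skewDerivK_act_b (k : Rq s μ) : hit (skewDerivK s μ) (k ◃ gen (s ^ 2) b) =
    (1 + (s : ℂ) ^ 2) • (k ◃ gen (s ^ 2) a) + (2 * (s : ℂ) ^ 3 * μ) • (k ◃ gen (s ^ 2) b) +
      (s : ℂ) ^ 2 • (hit (skewDerivK s μ) k ◃ gen (s ^ 2) b) := by
  have hY : hit (skewDeriv s μ) (gen (s ^ 2) b) =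
      (1 + (s : ℂ) ^ 2) • gen (s ^ 2) a + (2 * (s : ℂ) ^ 3 * μ) • gen (s ^ 2) b := by
    simp [hit_apply, comulGen, skewDeriv_gen, skewDerivGen]
  have hχ : hit (torusChar (s ^ 2)).toLinearMap (gen (s ^ 2) b) = (s : ℂ) ^ 2 • gen (s ^ 2) b := by
    simp [hit_apply, comulGen, torusChar]
  rw [hit_skewDerivK_act, hY, hχ, map_add, map_smul, map_smul, map_smul]

end Derivation

section Eigenvalue

variable (s : Circle) (μ : ℝ)

/-- The eigenvalue at `v_n` of the action of `Y` on `R_q`. -/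
noncomputable def eigenvalue (n : ℕ) : ℂ :=
  (s : ℂ) ^ 3 * μ / ((s : ℂ) ^ 2 - 1) * ((s : ℂ) ^ (2 * n) + ((s : ℂ) ^ (2 * n))⁻¹ - 2)

variable {s μ}

theorem pow_two_mul_injective (hq : ¬ IsOfFinOrder (s ^ 2)) :
    Function.Injective fun n : ℕ => (s : ℂ) ^ (2 * n) := fun m n h =>
  injective_pow_iff_not_isOfFinOrder.mpr hq <| Circle.ext <| by simpa [pow_mul] using h

theorem sq_sub_one_ne_zero (hq : ¬ IsOfFinOrder (s ^ 2)) : (s : ℂ) ^ 2 - 1 ≠ 0 := by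
  simpa [sub_eq_zero] using (pow_two_mul_injective hq).ne one_ne_zero

theorem sq_add_one_ne_zero (hq : ¬ IsOfFinOrder (s ^ 2)) : (s : ℂ) ^ 2 + 1 ≠ 0 := by
  intro h
  refine (pow_two_mul_injective hq).ne two_ne_zero ?_
  linear_combination ((s : ℂ) ^ 2 - 1) * h

theorem eigenvalue_injective (hq : ¬ IsOfFinOrder (s ^ 2)) (hμ : μ ≠ 0) :
    Function.Injective (eigenvalue s μ) := by
  intro m n h
  have hs₀ := Circle.coe_ne_zero s
  have hpref : (s : ℂ) ^ 3 * μ / ((s : ℂ) ^ 2 - 1) ≠ 0 :=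
    div_ne_zero (mul_ne_zero (pow_ne_zero _ hs₀) (Complex.ofReal_ne_zero.mpr hμ))
      (sq_sub_one_ne_zero hq)
  have hprod : ((s : ℂ) ^ (2 * m) - (s : ℂ) ^ (2 * n)) * ((s : ℂ) ^ (2 * (m + n)) - 1) = 0 := by
    have h' := mul_left_cancel₀ hpref h
    rw [mul_add, pow_add]
    field_simp at h'
    linear_combination h'
  rcases mul_eq_zero.mp hprod with h | h
  · exact pow_two_mul_injective hq (sub_eq_zero.mp h)
  · have hmn : m + n = 0 := pow_two_mul_injective hq (by simpa using sub_eq_zero.mp h)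
    omega

theorem skewDerivK_v (hq : ¬ IsOfFinOrder (s ^ 2)) (n : ℕ) :
    skewDerivK s μ (v s μ n) = eigenvalue s μ n := by
  induction n with
  | zero =>
    have h : skewDerivK s μ (v s μ 0) = triangularRep s μ 1 0 1 := rfl
    simp [h, eigenvalue, one_add_one_eq_two]
  | succ n ih =>
    have hs₀ := Circle.coe_ne_zero s
    have hq₁ := sq_sub_one_ne_zero hq
    rw [v_succ, skewDerivK_act, (isGroupLikeElem_v s μ n).counit_eq_one, ih, eigenvalue,
      eigenvalue]
    simp only [colTop, slope, torusChar, map_add, map_smul, skewDeriv_gen, skewDerivGen, lift_gen,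
      smul_eq_mul, mul_add, pow_add, Circle.coe_pow]
    field_simp
    ring

theorem hit_skewDerivK_v (hq : ¬ IsOfFinOrder (s ^ 2)) (n : ℕ) :
    hit (skewDerivK s μ) (v s μ n) = eigenvalue s μ n • v s μ n := by
  rw [hit_eq_of_isGroupLikeElem _ (isGroupLikeElem_v s μ n), skewDerivK_v hq]

end Eigenvalue

section Monomials

variable (s : Circle) (μ : ℝ)

/-- The vector `v_k · b^i`. -/
noncomputable def monom (k i : ℕ) : Rq s μ := v s μ k ◃ gen (s ^ 2) b ^ i

theorem monom_zero (k : ℕ) : monom s μ k 0 = v s μ k := by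
  rw [monom, pow_zero, act_one]

variable {s μ}

theorem monom_act_b (k i : ℕ) : monom s μ k i ◃ gen (s ^ 2) b = monom s μ k (i + 1) := by
  rw [monom, monom, pow_succ (gen (s ^ 2) b), act_mul]

theorem b_pow_mul_a (q : Circle) (i : ℕ) :
    gen q b ^ i * gen q a = ((q : ℂ) ^ i)⁻¹ • (gen q a * gen q b ^ i) := by
  have hq := q_ne_zero (q := q)
  induction i with
  | zero => simp
  | succ i ih =>
    have hba : gen q b * gen q a = (q : ℂ)⁻¹ • (gen q a * gen q b) := by
      rw [rel_ab, inv_smul_smul₀ hq]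
    rw [pow_succ, mul_assoc, hba, mul_smul_comm, ← mul_assoc, ih, smul_mul_assoc, smul_smul,
      mul_assoc, pow_succ (q : ℂ), mul_inv, mul_comm (q : ℂ)⁻¹]

theorem monom_act_a (k i : ℕ) : monom s μ k i ◃ gen (s ^ 2) a =
    ((s : ℂ) ^ (2 * i))⁻¹ • (monom s μ (k + 1) i - slope s μ k • monom s μ k (i + 1)) := by
  have hv : v s μ k ◃ gen (s ^ 2) a = v s μ (k + 1) - slope s μ k • (v s μ k ◃ gen (s ^ 2) b) := by
    rw [v_succ, colTop, map_add, map_smul, add_sub_cancel_right]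
  rw [monom, ← act_mul, b_pow_mul_a, map_smul, act_mul, hv, map_sub, map_smul,
    LinearMap.sub_apply, LinearMap.smul_apply, ← act_mul _ (gen (s ^ 2) b), ← pow_succ',
    Circle.coe_pow, ← pow_mul, monom, monom]

theorem counit_monom_succ (k i : ℕ) :
    Coalgebra.counit (R := ℂ) (monom s μ k (i + 1)) = 0 := by
  rw [monom, counit_act]
  simp [counitGen]

theorem qNum_sq (s : Circle) (n : ℕ) : qNum ((s : ℂ) ^ 2) n =
    ((s : ℂ) ^ (2 * n) - ((s : ℂ) ^ (2 * n))⁻¹) * (s : ℂ) ^ 2 /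
      (((s : ℂ) ^ 2 - 1) * ((s : ℂ) ^ 2 + 1)) := by
  have hs := Circle.coe_ne_zero s
  have hden : (s : ℂ) ^ 2 - ((s : ℂ) ^ 2)⁻¹ =
      (((s : ℂ) ^ 2 - 1) * ((s : ℂ) ^ 2 + 1)) / (s : ℂ) ^ 2 := by
    field_simp
    ring
  rw [qNum, ← pow_mul, hden, div_div_eq_mul_div]

theorem qNum_ne_zero (hq : ¬ IsOfFinOrder (s ^ 2)) (n : ℕ) :
    qNum ((s : ℂ) ^ 2) (n + 1) ≠ 0 := by
  have hs := Circle.coe_ne_zero s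
  rw [qNum_sq]
  refine div_ne_zero (mul_ne_zero (sub_ne_zero.mpr fun h => ?_) (pow_ne_zero _ hs))
    (mul_ne_zero (sq_sub_one_ne_zero hq) (sq_add_one_ne_zero hq))
  have hpow : (s : ℂ) ^ (2 * (n + 1 + (n + 1))) = 1 := by
    rw [mul_add, pow_add]
    exact (mul_eq_one_iff_eq_inv₀ (pow_ne_zero _ hs)).mpr h
  have := pow_two_mul_injective hq (a₁ := n + 1 + (n + 1)) (a₂ := 0) hpow
  omega

theorem qFact_ne_zero (hq : ¬ IsOfFinOrder (s ^ 2)) (n : ℕ) : qFact ((s : ℂ) ^ 2) n ≠ 0 :=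
  Finset.prod_ne_zero_iff.mpr fun i _ => qNum_ne_zero hq i

theorem qFact_succ (q : ℂ) (n : ℕ) : qFact q (n + 1) = qFact q n * qNum q (n + 1) :=
  Finset.prod_range_succ ..

theorem hit_skewDerivK_monom (hq : ¬ IsOfFinOrder (s ^ 2)) (k i : ℕ) :
    hit (skewDerivK s μ) (monom s μ k (i + 1)) =
      ((1 + (s : ℂ) ^ 2) * qNum ((s : ℂ) ^ 2) (i + 1)) • monom s μ (k + 1) i +
        (eigenvalue s μ (k + (i + 1)) - (1 + (s : ℂ) ^ 2) * ((s : ℂ) ^ 2 - ((s : ℂ) ^ 2)⁻¹) *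
          (s * μ) * qNum ((s : ℂ) ^ 2) (i + 1) * qNum ((s : ℂ) ^ 2) k) •
            monom s μ k (i + 1) := by
  have hs := Circle.coe_ne_zero s
  have hq₁ := sq_sub_one_ne_zero hq
  have hq₂ := sq_add_one_ne_zero hq
  have hk : (s : ℂ) ^ (2 * k) ≠ 0 := pow_ne_zero _ hs
  induction i with
  | zero =>
    rw [← monom_act_b, hit_skewDerivK_act_b, monom_act_a, monom_zero s μ k, hit_skewDerivK_v hq,
      map_smul, LinearMap.smul_apply, ← monom_zero s μ k]
    simp only [monom_act_b, qNum_sq, eigenvalue, slope, mul_add, pow_add]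
    generalize (s : ℂ) ^ (2 * k) = Q at *
    match_scalars <;> field_simp <;> ring
  | succ i ih =>
    have hi : (s : ℂ) ^ (2 * i) ≠ 0 := pow_ne_zero _ hs
    rw [← monom_act_b, hit_skewDerivK_act_b, ih, monom_act_a, map_add, map_smul, map_smul,
      LinearMap.add_apply, LinearMap.smul_apply, LinearMap.smul_apply]
    simp only [monom_act_b, qNum_sq, eigenvalue, slope, mul_add, pow_add]
    generalize (s : ℂ) ^ (2 * k) = Q at *
    generalize (s : ℂ) ^ (2 * i) = I at *
    match_scalars <;> field_simp <;> ring

end Monomials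

section JordanVector

variable (s : Circle) (μ : ℝ)

/-- The summand of `X_{k+i+1}` that is a multiple of `v_k · b^{i+1}`. -/
noncomputable def xTerm (k i : ℕ) : Rq s μ :=
  (((s : ℂ) ^ 2 - ((s : ℂ) ^ 2)⁻¹) ^ i * (s * μ) ^ (i + 1) * qFact ((s : ℂ) ^ 2) (k + i) /
    (qNum ((s : ℂ) ^ 2) (i + 1) * qFact ((s : ℂ) ^ 2) k)) • monom s μ k (i + 1)

/-- The terms of the telescoping sum that computes the action of `Y` on `X_{n+1}`. The factor
`[n + 1 - i]_q` cancels against the factorial for `i ≤ n`, and makes the last term vanish. -/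
noncomputable def telescopeTerm (n i : ℕ) : Rq s μ :=
  ((1 + (s : ℂ) ^ 2) * ((s : ℂ) ^ 2 - ((s : ℂ) ^ 2)⁻¹) ^ i * (s * μ) ^ (i + 1) *
    qFact ((s : ℂ) ^ 2) n * qNum ((s : ℂ) ^ 2) (n + 1 - i) / qFact ((s : ℂ) ^ 2) (n + 1 - i)) •
      monom s μ (n + 1 - i) i

variable {s μ}

theorem X_succ_eq_sum (n : ℕ) :
    X s μ (n + 1) = ∑ i ∈ Finset.range (n + 1), xTerm s μ (n - i) i := by
  rw [X, ← Finset.Ico_add_one_right_eq_Icc, Finset.range_eq_Ico]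
  refine (Finset.sum_Ico_add' _ 0 (n + 1) 1).symm.trans (Finset.sum_congr rfl fun i hi => ?_)
  have hin : i ≤ n := Nat.lt_succ_iff.mp (Finset.mem_Ico.mp hi).2
  rw [xTerm, Nat.sub_add_cancel hin, Nat.add_sub_cancel, Nat.add_sub_cancel,
    Nat.add_sub_add_right, mul_pow, ← mul_assoc]
  rfl

theorem counit_X_succ (n : ℕ) : Coalgebra.counit (R := ℂ) (X s μ (n + 1)) = 0 := by
  simp [X_succ_eq_sum, xTerm, counit_monom_succ]

theorem telescopeTerm_zero (hq : ¬ IsOfFinOrder (s ^ 2)) (n : ℕ) :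
    telescopeTerm s μ n 0 = ((1 + (s : ℂ) ^ 2) * (s * μ)) • v s μ (n + 1) := by
  have hn := qFact_ne_zero hq n
  have hn' := qNum_ne_zero hq n
  rw [telescopeTerm, Nat.sub_zero, monom_zero, qFact_succ, pow_zero, zero_add, pow_one]
  congr 1
  field_simp

theorem telescopeTerm_succ_self (n : ℕ) : telescopeTerm s μ n (n + 1) = 0 := by
  simp [telescopeTerm, qNum]

theorem hit_skewDerivK_xTerm (hq : ¬ IsOfFinOrder (s ^ 2)) (k i : ℕ) :
    hit (skewDerivK s μ) (xTerm s μ k i) = eigenvalue s μ (k + i + 1) • xTerm s μ k i +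
      (telescopeTerm s μ (k + i) i - telescopeTerm s μ (k + i) (i + 1)) := by
  have hk := qFact_ne_zero hq k
  have hk' := qNum_ne_zero hq k
  have hi := qNum_ne_zero hq i
  have hsub : k + i + 1 - i = k + 1 := by omega
  have hsub' : k + i + 1 - (i + 1) = k := by omega
  rw [xTerm, map_smul, hit_skewDerivK_monom hq, telescopeTerm, telescopeTerm, hsub, hsub',
    qFact_succ _ k, ← add_assoc]
  generalize (s : ℂ) ^ 2 - ((s : ℂ) ^ 2)⁻¹ = p
  match_scalars <;> field_simp
  ring

theorem hit_skewDerivK_X (hq : ¬ IsOfFinOrder (s ^ 2)) (n : ℕ) :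
    hit (skewDerivK s μ) (X s μ (n + 1)) = eigenvalue s μ (n + 1) • X s μ (n + 1) +
      ((1 + (s : ℂ) ^ 2) * (s * μ)) • v s μ (n + 1) := by
  have hit_term (i) (hi : i ∈ Finset.range (n + 1)) :
      hit (skewDerivK s μ) (xTerm s μ (n - i) i) = eigenvalue s μ (n + 1) • xTerm s μ (n - i) i +
        (telescopeTerm s μ n i - telescopeTerm s μ n (i + 1)) := by
    simpa only [Nat.sub_add_cancel (Finset.mem_range_succ_iff.mp hi)] using
      hit_skewDerivK_xTerm (μ := μ) hq (n - i) i
  rw [X_succ_eq_sum, map_sum, Finset.sum_congr rfl hit_term, Finset.sum_add_distrib,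
    ← Finset.smul_sum, Finset.sum_range_sub', telescopeTerm_zero hq, telescopeTerm_succ_self,
    sub_zero]

end JordanVector

section HomogeneousSpans

variable (s : Circle) (μ : ℝ)

/-- The span of the vectors `v_k · b^i` with `k + i = n`, which is the image in `R_q` of the
homogeneous elements of degree `n` of `SL_q(2)`. -/
noncomputable def homSpan (n : ℕ) : Submodule ℂ (Rq s μ) :=
  Submodule.span ℂ (Set.range fun i : Fin (n + 1) => monom s μ (n - i) i)

instance (n : ℕ) : FiniteDimensional ℂ (homSpan s μ n) :=
  FiniteDimensional.span_of_finite ℂ (Set.finite_range _)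

theorem finrank_homSpan_le (n : ℕ) : Module.finrank ℂ (homSpan s μ n) ≤ n + 1 := by
  simpa using! finrank_range_le_card (R := ℂ) fun i : Fin (n + 1) => monom s μ (n - i) i

variable {s μ}

theorem monom_mem_homSpan {k i n : ℕ} (h : k + i = n) : monom s μ k i ∈ homSpan s μ n :=
  Submodule.subset_span ⟨⟨i, by omega⟩, by simp [← h]⟩

theorem homSpan_le {n : ℕ} {p : Submodule ℂ (Rq s μ)}
    (h : ∀ k i, k + i = n → monom s μ k i ∈ p) : homSpan s μ n ≤ p := by
  refine Submodule.span_le.mpr ?_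
  rintro _ ⟨i, rfl⟩
  exact h _ _ (Nat.sub_add_cancel (Nat.lt_succ_iff.mp i.is_lt))

theorem v_mem_homSpan (n : ℕ) : v s μ n ∈ homSpan s μ n :=
  monom_zero s μ n ▸ monom_mem_homSpan (add_zero n)

theorem X_succ_mem_homSpan (n : ℕ) : X s μ (n + 1) ∈ homSpan s μ (n + 1) := by
  rw [X_succ_eq_sum]
  refine Submodule.sum_mem _ fun i hi => Submodule.smul_mem _ _ (monom_mem_homSpan ?_)
  have := Finset.mem_range.mp hi
  omega

theorem b_pow_mul_d (q : Circle) (i : ℕ) :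
    gen q b ^ i * gen q d = (q : ℂ) ^ i • (gen q d * gen q b ^ i) := by
  induction i with
  | zero => simp
  | succ i ih =>
    rw [pow_succ, mul_assoc, rel_bd, mul_smul_comm, ← mul_assoc, ih, smul_mul_assoc, smul_smul,
      mul_assoc, pow_succ' (q : ℂ)]

theorem monom_act_c (k i : ℕ) :
    monom s μ k i ◃ gen (s ^ 2) c = (-((s : ℂ) ^ 2 * (μ : ℂ) ^ 2)) • monom s μ k (i + 1) := by
  rw [monom, ← act_mul, (Commute.pow_left (rel_bc (q := s ^ 2)) i).eq, act_mul, v_act_c, map_smul,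
    LinearMap.smul_apply, ← act_mul, ← pow_succ', monom]

theorem monom_act_d (hμ : μ ≠ 0) (k i : ℕ) : monom s μ k i ◃ gen (s ^ 2) d =
    (s : ℂ) ^ (2 * i) • (monom s μ (k + 1) i +
      ((s : ℂ) * μ * ((s : ℂ) ^ (2 * k))⁻¹) • monom s μ k (i + 1)) := by
  rw [monom, ← act_mul, b_pow_mul_d, map_smul, act_mul, v_act_d s k hμ, map_add, map_smul,
    LinearMap.add_apply, LinearMap.smul_apply, ← act_mul _ (gen (s ^ 2) b), ← pow_succ',
    Circle.coe_pow, ← pow_mul, monom, monom]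

theorem act_gen_mem_homSpan (hμ : μ ≠ 0) (g : Gen) {n : ℕ} {x : Rq s μ}
    (hx : x ∈ homSpan s μ n) : x ◃ gen (s ^ 2) g ∈ homSpan s μ (n + 1) := by
  suffices h : homSpan s μ n ≤ (homSpan s μ (n + 1)).comap (act.flip (gen (s ^ 2) g)) from h hx
  refine homSpan_le fun k i hki => ?_
  have hmem₁ : monom s μ (k + 1) i ∈ homSpan s μ (n + 1) := monom_mem_homSpan (by omega)
  have hmem₂ : monom s μ k (i + 1) ∈ homSpan s μ (n + 1) := monom_mem_homSpan (by omega)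
  change monom s μ k i ◃ gen (s ^ 2) g ∈ homSpan s μ (n + 1)
  cases g with
  | a =>
    rw [monom_act_a]
    exact Submodule.smul_mem _ _ (sub_mem hmem₁ (Submodule.smul_mem _ _ hmem₂))
  | b => rwa [monom_act_b]
  | c =>
    rw [monom_act_c]
    exact Submodule.smul_mem _ _ hmem₂
  | d =>
    rw [monom_act_d hμ]
    exact Submodule.smul_mem _ _ (add_mem hmem₁ (Submodule.smul_mem _ _ hmem₂))

/-- Acting by `1 = ad - q bc` rewrites a vector in terms of vectors of degree higher by two. -/
theorem homSpan_le_add_two (hμ : μ ≠ 0) (n : ℕ) : homSpan s μ n ≤ homSpan s μ (n + 2) := by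
  intro x hx
  have hdet : x = x ◃ gen (s ^ 2) a ◃ gen (s ^ 2) d -
      ((s ^ 2 : Circle) : ℂ) • (x ◃ gen (s ^ 2) b ◃ gen (s ^ 2) c) := by
    rw [← act_mul, ← act_mul, ← map_smul, ← map_sub, rel_ad, act_one]
  have act_act_mem (g h : Gen) : x ◃ gen (s ^ 2) g ◃ gen (s ^ 2) h ∈ homSpan s μ (n + 2) :=
    act_gen_mem_homSpan hμ h (act_gen_mem_homSpan hμ g hx)
  rw [hdet]
  exact sub_mem (act_act_mem a d) (Submodule.smul_mem _ _ (act_act_mem b c))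

theorem iSup_homSpan (hμ : μ ≠ 0) : ⨆ n, homSpan s μ n = ⊤ := by
  set p := ⨆ n, homSpan s μ n
  have act_mem (y : SLq (s ^ 2)) : ∀ x ∈ p, x ◃ y ∈ p := by
    induction y using SLq.induction with
    | hs z =>
      intro x hx
      rw [Algebra.algebraMap_eq_smul_one, map_smul, act_one]
      exact p.smul_mem _ hx
    | hg g =>
      suffices h : p ≤ p.comap (act.flip (gen (s ^ 2) g)) from h
      exact iSup_le fun n x hx => Submodule.mem_iSup_of_mem (n + 1) (act_gen_mem_homSpan hμ g hx)
    | hm y z hy hz => exact fun x hx => act_mul x y z ▸ hz _ (hy x hx)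
    | ha y z hy hz => exact fun x hx => map_add (act x) y z ▸ add_mem (hy x hx) (hz x hx)
  refine eq_top_iff.mpr fun k _ => ?_
  obtain ⟨y, rfl⟩ := (coisoIdeal s μ (μ ^ 2)).mkQ_surjective k
  have hy := act_mem y (v s μ 0) (Submodule.mem_iSup_of_mem 0 (v_mem_homSpan 0))
  rwa [v, w, r_act, one_mul] at hy

end HomogeneousSpans

section Decomposition

variable {s : Circle} {μ : ℝ}

theorem jordanCoeff_ne_zero (hq : ¬ IsOfFinOrder (s ^ 2)) (hμ : μ ≠ 0) :
    (1 + (s : ℂ) ^ 2) * (s * μ) ≠ 0 :=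
  mul_ne_zero (add_comm (1 : ℂ) _ ▸ sq_add_one_ne_zero hq)
    (mul_ne_zero (Circle.coe_ne_zero s) (Complex.ofReal_ne_zero.mpr hμ))

theorem linearIndependent_v_X (hq : ¬ IsOfFinOrder (s ^ 2)) (hμ : μ ≠ 0) (n : ℕ) :
    LinearIndependent ℂ ![v s μ (n + 1), X s μ (n + 1)] :=
  linearIndependent_pair_of_apply_eq (hit_skewDerivK_v hq (n + 1)) (hit_skewDerivK_X hq n)
    (isGroupLikeElem_v s μ (n + 1)).ne_zero (jordanCoeff_ne_zero hq hμ)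

theorem component_zero : component s μ 0 = Submodule.span ℂ {v s μ 0} := if_pos rfl

theorem component_succ (n : ℕ) :
    component s μ (n + 1) = Submodule.span ℂ {v s μ (n + 1), X s μ (n + 1)} :=
  if_neg n.succ_ne_zero

theorem component_le_homSpan (n : ℕ) : component s μ n ≤ homSpan s μ n := by
  cases n with
  | zero => simpa [component_zero] using v_mem_homSpan 0
  | succ n =>
    rw [component_succ, Submodule.span_le, Set.pair_subset_iff]
    exact ⟨v_mem_homSpan (n + 1), X_succ_mem_homSpan n⟩

theorem finrank_component_succ (hq : ¬ IsOfFinOrder (s ^ 2)) (hμ : μ ≠ 0) (n : ℕ) :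
    Module.finrank ℂ (component s μ (n + 1)) = 2 := by
  rw [component_succ, ← Matrix.range_cons_cons_empty _ _ ![]]
  exact finrank_span_eq_card (linearIndependent_v_X hq hμ n)

theorem component_le_maxGenEigenspace (hq : ¬ IsOfFinOrder (s ^ 2)) (n : ℕ) :
    component s μ n ≤
      Module.End.maxGenEigenspace (hit (skewDerivK s μ)) (eigenvalue s μ n) := by
  have v_mem (m : ℕ) : v s μ m ∈
      Module.End.maxGenEigenspace (hit (skewDerivK s μ)) (eigenvalue s μ m) :=
    Module.End.eigenspace_le_maxGenEigenspace
      (Module.End.mem_eigenspace_iff.mpr (hit_skewDerivK_v hq m))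
  cases n with
  | zero => simpa [component_zero] using v_mem 0
  | succ n =>
    rw [component_succ, Submodule.span_le, Set.pair_subset_iff]
    exact ⟨v_mem (n + 1), mem_maxGenEigenspace_of_apply_eq (hit_skewDerivK_v hq (n + 1))
      (hit_skewDerivK_X hq n)⟩

theorem iSupIndep_component (hq : ¬ IsOfFinOrder (s ^ 2)) (hμ : μ ≠ 0) :
    iSupIndep (component s μ) :=
  ((Module.End.independent_maxGenEigenspace (hit (skewDerivK s μ))).comp
    (eigenvalue_injective hq hμ)).mono (component_le_maxGenEigenspace hq)

theorem homSpan_zero : homSpan s μ 0 = component s μ 0 := by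
  refine le_antisymm (homSpan_le fun k i h => ?_) (component_le_homSpan 0)
  obtain ⟨rfl, rfl⟩ := Nat.add_eq_zero_iff.mp h
  rw [monom_zero s μ 0, component_zero]
  exact Submodule.mem_span_singleton_self _

theorem homSpan_one (hq : ¬ IsOfFinOrder (s ^ 2)) (hμ : μ ≠ 0) :
    homSpan s μ 1 = component s μ 1 :=
  (Submodule.eq_of_le_of_finrank_le (component_le_homSpan 1)
    ((finrank_homSpan_le s μ 1).trans (finrank_component_succ hq hμ 0).ge)).symm

theorem homSpan_le_iSup_component_and_finrank_homSpan (hq : ¬ IsOfFinOrder (s ^ 2))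
    (hμ : μ ≠ 0) (n : ℕ) : homSpan s μ n ≤ ⨆ m ≤ n, component s μ m ∧
      Module.finrank ℂ (homSpan s μ n) = n + 1 := by
  induction n using Nat.twoStepInduction with
  | zero =>
    rw [homSpan_zero]
    refine ⟨le_iSup₂_of_le 0 le_rfl le_rfl, ?_⟩
    rw [component_zero, finrank_span_singleton (isGroupLikeElem_v s μ 0).ne_zero]
  | one =>
    rw [homSpan_one hq hμ]
    exact ⟨le_iSup₂_of_le 1 le_rfl le_rfl, finrank_component_succ hq hμ 0⟩
  | more n ih _ =>
    have hdisj : Disjoint (homSpan s μ n) (component s μ (n + 2)) :=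
      ((iSupIndep_component hq hμ (n + 2)).mono_right <| ih.1.trans <|
        iSup₂_le fun m hm => le_iSup₂_of_le m (by omega) le_rfl).symm
    have hsup : homSpan s μ n ⊔ component s μ (n + 2) = homSpan s μ (n + 2) := by
      refine sup_eq_of_disjoint_of_finrank_le hdisj (homSpan_le_add_two hμ n)
        (component_le_homSpan (n + 2)) ?_
      rw [ih.2, finrank_component_succ hq hμ (n + 1)]
      exact finrank_homSpan_le s μ (n + 2)
    constructor
    · rw [← hsup]
      exact sup_le (ih.1.trans (biSup_mono fun m hm => by omega))
        (le_iSup₂_of_le (n + 2) le_rfl le_rfl)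
    · have := Submodule.finiteDimensional_of_le (component_le_homSpan (s := s) (μ := μ) (n + 2))
      have := Submodule.finrank_sup_add_finrank_inf_eq (homSpan s μ n) (component s μ (n + 2))
      rw [hdisj.eq_bot, finrank_bot, hsup, ih.2, finrank_component_succ hq hμ (n + 1)] at this
      exact this

theorem iSup_component (hq : ¬ IsOfFinOrder (s ^ 2)) (hμ : μ ≠ 0) : ⨆ n, component s μ n = ⊤ := by
  refine eq_top_iff.mpr (iSup_homSpan hμ ▸ iSup_le fun n => ?_)
  exact (homSpan_le_iSup_component_and_finrank_homSpan hq hμ n).1.trans (iSup₂_le_iSup _ _)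

theorem isInternal_component (hq : ¬ IsOfFinOrder (s ^ 2)) (hμ : μ ≠ 0) :
    DirectSum.IsInternal (component s μ) :=
  DirectSum.isInternal_submodule_of_iSupIndep_of_iSup_eq_top (iSupIndep_component hq hμ)
    (iSup_component hq hμ)

end Decomposition

section GroupLikeAndPrimitive

variable {s : Circle} {μ : ℝ}

theorem maxGenEigenspace_eigenvalue (hq : ¬ IsOfFinOrder (s ^ 2)) (hμ : μ ≠ 0) (n : ℕ) :
    Module.End.maxGenEigenspace (hit (skewDerivK s μ)) (eigenvalue s μ n) = component s μ n := by
  rw [maxGenEigenspace_eq_iSup_of_le (component_le_maxGenEigenspace hq) (iSup_component hq hμ)]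
  simp only [(eigenvalue_injective hq hμ).eq_iff, iSup_iSup_eq_left]

theorem iSup_maxGenEigenspace_hit_skewDerivK (hq : ¬ IsOfFinOrder (s ^ 2)) (hμ : μ ≠ 0) :
    ⨆ t, Module.End.maxGenEigenspace (hit (skewDerivK s μ)) t = ⊤ :=
  eq_top_iff.mpr <| iSup_component hq hμ ▸ iSup_le fun n =>
    (component_le_maxGenEigenspace hq n).trans (le_iSup _ _)

theorem mem_span_v_of_hit_eq (hq : ¬ IsOfFinOrder (s ^ 2)) (hμ : μ ≠ 0) {n : ℕ} {x : Rq s μ}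
    (hx : hit (skewDerivK s μ) x = eigenvalue s μ n • x) : x ∈ Submodule.span ℂ {v s μ n} := by
  have hmem : x ∈ component s μ n := maxGenEigenspace_eigenvalue hq hμ n ▸
    Module.End.eigenspace_le_maxGenEigenspace (Module.End.mem_eigenspace_iff.mpr hx)
  cases n with
  | zero => rwa [component_zero] at hmem
  | succ n =>
    rw [component_succ] at hmem
    exact mem_span_singleton_of_mem_span_pair_of_apply_eq (hit_skewDerivK_v hq (n + 1))
      (hit_skewDerivK_X hq n) (isGroupLikeElem_v s μ (n + 1)).ne_zero (jordanCoeff_ne_zero hq hμ)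
      hx hmem

theorem eq_zero_of_mem_span_v_of_counit_eq_zero {n : ℕ} {x : Rq s μ}
    (hx : x ∈ Submodule.span ℂ {v s μ n}) (hε : Coalgebra.counit (R := ℂ) x = 0) : x = 0 := by
  obtain ⟨z, rfl⟩ := Submodule.mem_span_singleton.mp hx
  obtain rfl : z = 0 := by simpa [(isGroupLikeElem_v s μ n).counit_eq_one] using hε
  exact zero_smul ℂ _

theorem skewDerivK_X (hq : ¬ IsOfFinOrder (s ^ 2)) (n : ℕ) :
    skewDerivK s μ (X s μ (n + 1)) = (1 + (s : ℂ) ^ 2) * (s * μ) := by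
  rw [← counit_hit, hit_skewDerivK_X hq, map_add, map_smul, map_smul, counit_X_succ,
    (isGroupLikeElem_v s μ (n + 1)).counit_eq_one, smul_zero, zero_add, smul_eq_mul, mul_one]

theorem isPrimitiveOver_X (hq : ¬ IsOfFinOrder (s ^ 2)) (hμ : μ ≠ 0) (n : ℕ) :
    IsPrimitiveOver ℂ (v s μ (n + 1)) (X s μ (n + 1)) := by
  refine isPrimitiveOver_of_hit_eq (isGroupLikeElem_v s μ (n + 1)) (f := skewDerivK s μ)
    (fun y hy hε => ?_) ?_ (counit_X_succ n)
  · rw [skewDerivK_v hq] at hy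
    exact eq_zero_of_mem_span_v_of_counit_eq_zero (mem_span_v_of_hit_eq hq hμ hy) hε
  · rw [hit_skewDerivK_X hq, skewDerivK_v hq, skewDerivK_X hq]

theorem isCocommSubcoalgebra_component (hq : ¬ IsOfFinOrder (s ^ 2)) (hμ : μ ≠ 0) (n : ℕ) :
    IsCocommSubcoalgebra (component s μ n) := by
  cases n with
  | zero =>
    rw [component_zero]
    exact isCocommSubcoalgebra_span_of_isGroupLikeElem (isGroupLikeElem_v s μ 0)
  | succ n =>
    rw [component_succ]
    exact isCocommSubcoalgebra_span_pair (isGroupLikeElem_v s μ (n + 1)) (isPrimitiveOver_X hq hμ n)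

theorem eigenvalue_mem_range (hq : ¬ IsOfFinOrder (s ^ 2)) (hμ : μ ≠ 0) {t : ℂ} {x : Rq s μ}
    (hx : Module.End.HasEigenvector (hit (skewDerivK s μ)) t x) : ∃ n, eigenvalue s μ n = t := by
  by_contra! ht
  have hmem : x ∈ Module.End.maxGenEigenspace (hit (skewDerivK s μ)) t :=
    Module.End.eigenspace_le_maxGenEigenspace hx.1
  rw [maxGenEigenspace_eq_iSup_of_le (component_le_maxGenEigenspace hq) (iSup_component hq hμ)]
    at hmem
  exact hx.2 (by simpa [ht] using hmem)

theorem exists_v_mem (hq : ¬ IsOfFinOrder (s ^ 2)) (hμ : μ ≠ 0) {p : Submodule ℂ (Rq s μ)}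
    (hp : p ≠ ⊥) (hstable : ∀ x ∈ p, hit (skewDerivK s μ) x ∈ p) : ∃ n, v s μ n ∈ p := by
  obtain ⟨t, x, hxp, hx⟩ := exists_eigenvector_mem_of_iSup_maxGenEigenspace_eq_top
    (iSup_maxGenEigenspace_hit_skewDerivK hq hμ) hp hstable
  obtain ⟨n, rfl⟩ := eigenvalue_mem_range hq hμ hx
  obtain ⟨z, rfl⟩ := Submodule.mem_span_singleton.mp
    (mem_span_v_of_hit_eq hq hμ hx.apply_eq_smul)
  exact ⟨n, (p.smul_mem_iff (left_ne_zero_of_smul hx.2)).mp hxp⟩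

theorem isSimpleSubcoalgebra_iff (hq : ¬ IsOfFinOrder (s ^ 2)) (hμ : μ ≠ 0)
    (D : Submodule ℂ (Rq s μ)) :
    IsSimpleSubcoalgebra D ↔ ∃ n, D = Submodule.span ℂ {v s μ n} := by
  constructor
  · rintro ⟨hD, hne, hsimple⟩
    obtain ⟨n, hn⟩ := exists_v_mem hq hμ hne fun x => hD.hit_mem (skewDerivK s μ)
    have hline := isSimpleSubcoalgebra_span_of_isGroupLikeElem (isGroupLikeElem_v s μ n)
    exact ⟨n, ((hsimple _ hline.1 ((Submodule.span_singleton_le_iff_mem _ _).mpr hn)).resolve_left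
      hline.2.1).symm⟩
  · rintro ⟨n, rfl⟩
    exact isSimpleSubcoalgebra_span_of_isGroupLikeElem (isGroupLikeElem_v s μ n)

theorem isPointedCoalgebra_Rq (hq : ¬ IsOfFinOrder (s ^ 2)) (hμ : μ ≠ 0) :
    IsPointedCoalgebra (Rq s μ) := by
  intro D hD
  obtain ⟨n, rfl⟩ := (isSimpleSubcoalgebra_iff hq hμ D).mp hD
  exact finrank_span_singleton (isGroupLikeElem_v s μ n).ne_zero

theorem eq_zero_of_isPrimitiveOver_v_zero (hq : ¬ IsOfFinOrder (s ^ 2)) (hμ : μ ≠ 0)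
    {x : Rq s μ} (hx : IsPrimitiveOver ℂ (v s μ 0) x) : x = 0 := by
  have hv := isGroupLikeElem_v s μ 0
  have hmem : x ∈ component s μ 0 := maxGenEigenspace_eigenvalue hq hμ 0 ▸
    mem_maxGenEigenspace_of_apply_eq (hit_skewDerivK_v hq 0)
      (skewDerivK_v (μ := μ) hq 0 ▸ hx.hit_eq (skewDerivK s μ))
  exact eq_zero_of_mem_span_v_of_counit_eq_zero (component_zero ▸ hmem) (hx.counit_eq_zero hv)

theorem isEmpty_hopfAlgebra_coalgEquiv_Rq (hq : ¬ IsOfFinOrder (s ^ 2)) (hμ : μ ≠ 0)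
    (H : Type*) [Ring H] [HopfAlgebra ℂ H] : IsEmpty (H ≃ₗc[ℂ] Rq s μ) :=
  isEmpty_hopfAlgebra_coalgEquiv (isGroupLikeElem_v s μ 0)
    (fun _ => eq_zero_of_isPrimitiveOver_v_zero hq hμ) (isGroupLikeElem_v s μ 1)
    (isPrimitiveOver_X hq hμ 0) ((linearIndependent_v_X hq hμ 0).ne_zero 1) H

end GroupLikeAndPrimitive

end QuantumSL2

theorem mainTheorem1 (s : Circle) (hs : ∀ n : ℕ, 0 < n → (s ^ 2) ^ n ≠ 1)
    (μ : ℝ) (hμ : μ ≠ 0) :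
    (DirectSum.IsInternal (QuantumSL2.component s μ) ∧
      ∀ n, IsCocommSubcoalgebra (QuantumSL2.component s μ n)) ∧
    ((∀ n, IsGroupLikeElem ℂ (QuantumSL2.v s μ n)) ∧
      (∀ D : Submodule ℂ (QuantumSL2.Rq s μ),
        IsSimpleSubcoalgebra D ↔ ∃ n, D = Submodule.span ℂ {QuantumSL2.v s μ n}) ∧
      IsPointedCoalgebra (QuantumSL2.Rq s μ) ∧
      ∀ n, IsUnitaryCorepresentation (QuantumSL2.tauK s μ (μ ^ 2))
        (oneDimCorep (QuantumSL2.v s μ n))) ∧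
    ∀ (H : Type*) [Ring H] [HopfAlgebra ℂ H], IsEmpty (H ≃ₗc[ℂ] QuantumSL2.Rq s μ) := by
  have hq : ¬ IsOfFinOrder (s ^ 2) := fun h =>
    let ⟨n, hn, hpow⟩ := isOfFinOrder_iff_pow_eq_one.mp h
    hs n hn hpow
  have hv := QuantumSL2.isGroupLikeElem_v s μ
  exact ⟨⟨QuantumSL2.isInternal_component hq hμ, QuantumSL2.isCocommSubcoalgebra_component hq hμ⟩,
    ⟨hv, QuantumSL2.isSimpleSubcoalgebra_iff hq hμ, QuantumSL2.isPointedCoalgebra_Rq hq hμ,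
      fun n => isUnitaryCorepresentation_oneDimCorep (hv n) (QuantumSL2.tauK_v s n hμ)⟩,
    QuantumSL2.isEmpty_hopfAlgebra_coalgEquiv_Rq hq hμ⟩
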